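/- **Conventions.** All manifolds, maps, forms and vector fields are smooth. Manifolds and Lie groups may be finite-dimensional or modelled on real Banach spaces; $\iota$ denotes contraction, with $\iota(v_1\wedge\cdots\wedge v_k)\omega=\iota_{v_k}\cdots\iota_{v_1}\omega=\omega(v_1,\dots,v_k,\cdot,\dots)$, and $\varsigma(k)=-(-1)^{k(k+1)/2}$. Let $n\ge 1$. A *pre-$n$-plectic manifold* $(M,\omega)$ is a manifold with a closed $(n+1)$-form $\omega$. An $(n-1)$-form $\alpha$ is *Hamiltonian* if $d\alpha=-\iota_{v}\omega$ for some vector field $v$, which is then called a Hamiltonian vector field of $\alpha$; $\Omega^{n-1}_{\mathrm{Ham}}(M)$ is the space of these forms. The *Lie $n$-algebra of observables* $L_\infty(M,\omega)$ is the $L_\infty$-algebra with $L^0=\Omega^{n-1}_{\mathrm{Ham}}(M)$, $L^{i}=\Omega^{n-1+i}(M)$ for $1-n\le i<0$, and $L^i=0$ otherwise, with $l_1=d$ on $L^i$ for $i<0$, $l_1=0$ on $L^0$, and for $k\ge2$ $$l_k(\alpha_1,\dots,\alpha_k)=\varsigma(k)\,\iota(v_{1}\wedge\cdots\wedge v_{k})\omega$$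 if all $\alpha_i$ lie in $L^0$, where $v_i$ is any Hamiltonian vector field of $\alpha_i$, and $l_k(\alpha_1,\dots,\alpha_k)=0$ if some $\alpha_i$ has negative degree. Let a Lie group $G$ with Lie algebra $\mathfrak g$ act on $M$, and for $x\in\mathfrak g$ let $v_x|_p=\frac{d}{dt}\big|_{t=0}\exp(-tx)\cdot p$. The group $G$ acts *via Hamiltonian vector fields* if every $v_x$ is a Hamiltonian vector field. A *homotopy moment map* is an $L_\infty$-morphism $(f_k)\colon\mathfrak g\to L_\infty(M,\omega)$, where $\mathfrak g$ is concentrated in degree $0$ (so its components are linear maps $f_k\colon\Lambda^k\mathfrak g\to L^{1-k}$), such that $d(f_1(x))=-\iota_{v_x}\omega$ for all $x\in\mathfrak g$. Let $\delta_{\mathrm{CE}}$ be the Chevalley–Eilenberg differential $(\delta_{\mathrm{CE}}c)(x_1,\dots,x_{k+1})=\sum_{i<j}(-1)^{i+j}c([x_i,x_j],x_1,\dots,\hat x_i,\dots,\hat x_j,\dots,x_{k+1})$ on $\operatorname{Hom}(\Lambda^\bullet\mathfrak g,\mathbb R)$, and $H^\bullet_{\mathrm{CE}}(\mathfrak g)$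 its cohomology. For $p\in M$ the cochain $$c^{\mathfrak g}_p(x_1,\dots,x_{n+1})=(-1)^n\varsigma(n+1)\,\iota(v_{x_1}\wedge\cdots\wedge v_{x_{n+1}})\omega\big|_p$$ is a cocycle, and if $M$ is connected its class does not depend on $p$. **Theorem.** Let $(M,\omega)$ be a connected pre-$n$-plectic manifold with an action of a Lie group $G$ via Hamiltonian vector fields, and let $\phi\colon\mathfrak g\to\Omega^{n-1}_{\mathrm{Ham}}(M)$ be any linear map with $d\phi(x)=-\iota_{v_x}\omega$ for all $x\in\mathfrak g$. Suppose that $H^i_{\mathrm{dR}}(M)=0$ for $1\le i\le n-1$, and that $[c^{\mathfrak g}_p]=0$ in $H^{n+1}_{\mathrm{CE}}(\mathfrak g)$ for some $p\in M$. Then there exists a homotopy moment map $(f_k)\colon\mathfrak g\to L_\infty(M,\omega)$ such that - $f_1=\phi$ if $n\ge 2$; - $f_1=\phi+b$ for some linear map $b\colon\mathfrak g\to\mathbb R$ (with values in the constant functions) if $n=1$. -/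

import Mathlib

open scoped Manifold ContDiff Topology
open Set

namespace HomotopyMoment
section
variable {E M : Type*} [NormedAddCommGroup E] [NormedSpace ℝ E] [TopologicalSpace M] [ChartedSpace E M]

/-- A (not necessarily smooth) `k`-form on `M`: a continuous alternating `k`-linear form on each tangent
space. -/
def FormField (E M : Type*) [NormedAddCommGroup E] [NormedSpace ℝ E] [TopologicalSpace M]
    [ChartedSpace E M] (k : ℕ) : Type _ :=
  (p : M) → TangentSpace 𝓘(ℝ, E) p [⋀^Fin k]→L[ℝ] ℝ

noncomputable instance (k : ℕ) : AddCommGroup (FormField E M k) :=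
  inferInstanceAs (AddCommGroup ((p : M) → TangentSpace 𝓘(ℝ, E) p [⋀^Fin k]→L[ℝ] ℝ))

noncomputable instance (k : ℕ) : Module ℝ (FormField E M k) :=
  inferInstanceAs (Module ℝ ((p : M) → TangentSpace 𝓘(ℝ, E) p [⋀^Fin k]→L[ℝ] ℝ))

/-- The representative of a `k`-form in a chart `φ`, i.e. its pullback under `φ⁻¹`. -/
noncomputable def chartRep {k : ℕ} (φ : OpenPartialHomeomorph M E) (η : FormField E M k) (y : E) :
    E [⋀^Fin k]→L[ℝ] ℝ :=
  (η (φ.symm y)).compContinuousLinearMap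
    (mfderiv 𝓘(ℝ, E) 𝓘(ℝ, E) φ.symm y : E →L[ℝ] TangentSpace 𝓘(ℝ, E) (φ.symm y))

variable (E M) in
/-- `Ω^k(M)`: the `k`-forms whose representatives in all charts are smooth. -/
noncomputable def Form (k : ℕ) : Submodule ℝ (FormField E M k) where
  carrier := {η | ∀ φ ∈ atlas E M, ContDiffOn ℝ ∞ (chartRep φ η) φ.target}
  add_mem' ha hb φ hφ := (ha φ hφ).add (hb φ hφ)
  zero_mem' _ _ := (contDiffOn_const (c := (0 : E [⋀^Fin k]→L[ℝ] ℝ)))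
  smul_mem' c _ ha φ hφ := (ha φ hφ).const_smul c

/-- The exterior derivative, computed at `p` in the preferred chart at `p`. -/
noncomputable def dField {k : ℕ} (η : FormField E M k) : FormField E M (k+1) := fun p =>
  (extDeriv (chartRep (chartAt E p) η) (chartAt E p p)).compContinuousLinearMap
    (mfderiv 𝓘(ℝ, E) 𝓘(ℝ, E) (chartAt E p) p : TangentSpace 𝓘(ℝ, E) p →L[ℝ] E)

theorem mfderiv_symm_eq_comp [IsManifold 𝓘(ℝ, E) ∞ M] {φ ψ : OpenPartialHomeomorph M E}
    (hφ : φ ∈ atlas E M) (hψ : ψ ∈ atlas E M) {z : E} (hz : z ∈ φ.target)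
    (hz' : φ.symm z ∈ ψ.source) :
    (mfderiv 𝓘(ℝ, E) 𝓘(ℝ, E) φ.symm z : E →L[ℝ] E) =
      (mfderiv 𝓘(ℝ, E) 𝓘(ℝ, E) ψ.symm (ψ (φ.symm z)) : E →L[ℝ] E).comp
        (fderiv ℝ (fun z => ψ (φ.symm z) : E → E) z) := by
  have hM : IsManifold 𝓘(ℝ, E) 1 M := inferInstance
  have h1 : MDifferentiableAt 𝓘(ℝ, E) 𝓘(ℝ, E) φ.symm z := mdifferentiableAt_atlas_symm hφ hz
  have h2 : MDifferentiableAt 𝓘(ℝ, E) 𝓘(ℝ, E) ψ (φ.symm z) := mdifferentiableAt_atlas hψ hz'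
  have h3 : MDifferentiableAt 𝓘(ℝ, E) 𝓘(ℝ, E) ψ.symm (ψ (φ.symm z)) :=
    mdifferentiableAt_atlas_symm hψ (ψ.map_source hz')
  have h4 : MDifferentiableAt 𝓘(ℝ, E) 𝓘(ℝ, E) (fun z => ψ (φ.symm z)) z := h2.comp z h1
  have h5 := h3.hasMFDerivAt.comp z h4.hasMFDerivAt
  have h6 : φ.symm =ᶠ[𝓝 z] ψ.symm ∘ (fun z => ψ (φ.symm z)) := by
    filter_upwards [(φ.continuousAt_symm hz).preimage_mem_nhds (ψ.open_source.mem_nhds hz')]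
      with y hy using (ψ.left_inv hy).symm
  have h7 := (h5.congr_of_eventuallyEq h6).mfderiv
  rw [mfderiv_eq_fderiv] at h7
  exact h7

theorem chartRep_eq_pullback [IsManifold 𝓘(ℝ, E) ∞ M] {k : ℕ} {φ ψ : OpenPartialHomeomorph M E}
    (hφ : φ ∈ atlas E M) (hψ : ψ ∈ atlas E M) (η : FormField E M k) {z : E} (hz : z ∈ φ.target)
    (hz' : φ.symm z ∈ ψ.source) :
    chartRep φ η z = (chartRep ψ η (ψ (φ.symm z))).compContinuousLinearMap
      (fderiv ℝ (fun z => ψ (φ.symm z)) z) := by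
  have key : ∀ r r' : M, r = r' →
      (η r : E [⋀^Fin k]→L[ℝ] ℝ) = (η r' : E [⋀^Fin k]→L[ℝ] ℝ) := by
    rintro r _ rfl; rfl
  have e := key _ _ (ψ.left_inv hz')
  have h := mfderiv_symm_eq_comp hφ hψ hz hz'
  unfold chartRep
  ext w
  have h1 : ∀ a b : E [⋀^Fin k]→L[ℝ] ℝ, a = b → ∀ A B : E →L[ℝ] E, A = B →
      a (fun i => A (w i)) = b (fun i => B (w i)) := by
    rintro a _ rfl A _ rfl; rfl
  exact h1 _ _ e.symm _ _ h

/-- In every chart, the exterior derivative of a smooth form is represented by the exterior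
derivative of its representative. -/
theorem chartRep_dField [IsManifold 𝓘(ℝ, E) ∞ M] {k : ℕ} {φ : OpenPartialHomeomorph M E}
    (hφ : φ ∈ atlas E M) {η : FormField E M k} (hη : η ∈ Form E M k) {y : E} (hy : y ∈ φ.target) :
    chartRep φ (dField η) y = extDeriv (chartRep φ η) y := by
  have hM : IsManifold 𝓘(ℝ, E) 1 M := inferInstance
  set q := φ.symm y with hq
  set ψ := chartAt E q with hψdef
  have hψ : ψ ∈ atlas E M := chart_mem_atlas E q
  have hqs : q ∈ ψ.source := mem_chart_source E q
  have hev : chartRep φ η =ᶠ[𝓝 y] fun z => (chartRep ψ η (ψ (φ.symm z))).compContinuousLinearMap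
      (fderiv ℝ (fun z => ψ (φ.symm z)) z) := by
    filter_upwards [φ.open_target.mem_nhds hy,
      (φ.continuousAt_symm hy).preimage_mem_nhds (ψ.open_source.mem_nhds hqs)] with z hz hz'
    exact chartRep_eq_pullback hφ hψ η hz hz'
  have hdiff : DifferentiableAt ℝ (chartRep ψ η) (ψ q) :=
    ((hη ψ hψ).contDiffAt (ψ.open_target.mem_nhds (ψ.map_source hqs))).differentiableAt (by simp)
  have hsm : ContDiffAt ℝ ∞ (fun z => ψ (φ.symm z)) y := by
    rw [← contMDiffAt_iff_contDiffAt]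
    exact (contMDiffAt_of_mem_maximalAtlas (IsManifold.subset_maximalAtlas hψ) hqs).comp y
      (contMDiffAt_symm_of_mem_maximalAtlas (IsManifold.subset_maximalAtlas hφ) hy)
  have hpull := extDeriv_pullback (f := fun z => ψ (φ.symm z)) (x := y)
    (r := ∞) hdiff hsm (by simpa using (ENat.LEInfty.out : (2 : WithTop ℕ∞) ≤ ∞))
  rw [hev.extDeriv_eq, hpull]
  have h1 : MDifferentiableAt 𝓘(ℝ, E) 𝓘(ℝ, E) φ.symm y := mdifferentiableAt_atlas_symm hφ hy
  have h2 : MDifferentiableAt 𝓘(ℝ, E) 𝓘(ℝ, E) ψ (φ.symm y) := mdifferentiableAt_atlas hψ hqs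
  have h3 : fderiv ℝ (fun z => ψ (φ.symm z) : E → E) y =
      (mfderiv 𝓘(ℝ, E) 𝓘(ℝ, E) ψ q : E →L[ℝ] E).comp
        (mfderiv 𝓘(ℝ, E) 𝓘(ℝ, E) φ.symm y : E →L[ℝ] E) := by
    rw [← mfderiv_eq_fderiv]
    exact mfderiv_comp y h2 h1
  rw [h3]
  rfl

theorem dField_mem [IsManifold 𝓘(ℝ, E) ∞ M] {k : ℕ} {η : FormField E M k} (hη : η ∈ Form E M k) :
    dField η ∈ Form E M (k + 1) := by
  intro φ hφ
  have h : ContDiffOn ℝ ∞ (fderiv ℝ (chartRep φ η)) φ.target :=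
    (hη φ hφ).fderiv_of_isOpen φ.open_target (by simp)
  let L := ContinuousAlternatingMap.alternatizeUncurryFinCLM (n := k) ℝ E ℝ
  have h2 : ContDiffOn ℝ ∞ (L ∘ fderiv ℝ (chartRep φ η)) φ.target :=
    L.contDiff.comp_contDiffOn h
  exact h2.congr fun y hy => chartRep_dField hφ hη hy

theorem Form.differentiableAt_chartRep {k : ℕ} (η : Form E M k) (p : M) :
    DifferentiableAt ℝ (chartRep (chartAt E p) η.1) (chartAt E p p) :=
  ((η.2 _ (chart_mem_atlas E p)).contDiffAt
    ((chartAt E p).open_target.mem_nhds (mem_chart_target E p))).differentiableAt (by simp)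

/-- The de Rham differential `d : Ω^k(M) → Ω^{k+1}(M)`. -/
noncomputable def extD [IsManifold 𝓘(ℝ, E) ∞ M] (k : ℕ) : Form E M k →ₗ[ℝ] Form E M (k+1) where
  toFun η := ⟨dField η.1, dField_mem η.2⟩
  map_add' a b := by
    refine Subtype.ext (funext fun p => ?_)
    have h := extDeriv_add (Form.differentiableAt_chartRep a p) (Form.differentiableAt_chartRep b p)
    ext w
    exact congrArg (fun (ζ : E [⋀^Fin (k + 1)]→L[ℝ] ℝ) => ζ fun i =>
      (mfderiv 𝓘(ℝ, E) 𝓘(ℝ, E) (chartAt E p) p : E →L[ℝ] E) (w i)) h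
  map_smul' c a := by
    refine Subtype.ext (funext fun p => ?_)
    have h := extDeriv_smul c (chartRep (chartAt E p) a.1) (x := chartAt E p p)
    ext w
    exact congrArg (fun (ζ : E [⋀^Fin (k + 1)]→L[ℝ] ℝ) => ζ fun i =>
      (mfderiv 𝓘(ℝ, E) 𝓘(ℝ, E) (chartAt E p) p : E →L[ℝ] E) (w i)) h

/-- Smooth vector fields on `M`. -/
abbrev VField (E M : Type*) [NormedAddCommGroup E] [NormedSpace ℝ E] [TopologicalSpace M]
    [ChartedSpace E M] [IsManifold 𝓘(ℝ, E) ∞ M] : Type _ :=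
  ContMDiffSection 𝓘(ℝ, E) E ∞ (TangentSpace 𝓘(ℝ, E) : M → Type _)

/-- The representative of a vector field in a chart. -/
noncomputable def chartVec (φ : OpenPartialHomeomorph M E)
    (v : (p : M) → TangentSpace 𝓘(ℝ, E) p) (y : E) : E :=
  (mfderiv 𝓘(ℝ, E) 𝓘(ℝ, E) φ (φ.symm y) :
    TangentSpace 𝓘(ℝ, E) (φ.symm y) →L[ℝ] E) (v (φ.symm y))

theorem contDiffOn_chartVec [IsManifold 𝓘(ℝ, E) ∞ M] {φ : OpenPartialHomeomorph M E}
    (hφ : φ ∈ atlas E M) (v : VField E M) : ContDiffOn ℝ ∞ (chartVec φ v) φ.target := by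
  have h1 : ContMDiffOn 𝓘(ℝ, E) 𝓘(ℝ, E).tangent ∞
      (fun y => (⟨φ.symm y, v (φ.symm y)⟩ : TangentBundle 𝓘(ℝ, E) M)) φ.target :=
    v.contMDiff.comp_contMDiffOn
      (contMDiffOn_symm_of_mem_maximalAtlas (IsManifold.subset_maximalAtlas hφ))
  have h2 := (contMDiffOn_of_mem_maximalAtlas (I := 𝓘(ℝ, E)) (n := ∞)
    (IsManifold.subset_maximalAtlas hφ)).contMDiffOn_tangentMapWithin (m := ∞) (by simp)
      φ.open_source.uniqueMDiffOn
  have h3 := h2.comp h1 (fun y hy => φ.map_target hy)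
  refine contMDiffOn_vectorSpace_iff_contDiffOn.1 (h3.congr fun y hy => ?_)
  simp only [Function.comp, tangentMapWithin, chartVec]
  rw [mfderivWithin_of_isOpen φ.open_source (φ.map_target hy), φ.right_inv hy]

/-- `(ι_v η)_p(w₁, …, w_k) = η_p(v_p, w₁, …, w_k)`. -/
noncomputable def interiorField {k : ℕ} (v : (p : M) → TangentSpace 𝓘(ℝ, E) p)
    (η : FormField E M (k + 1)) : FormField E M k := fun p =>
  ContinuousAlternatingMap.curryLeft (E := E) (η p) (v p)

theorem chartRep_interiorField [IsManifold 𝓘(ℝ, E) ∞ M] {k : ℕ} {φ : OpenPartialHomeomorph M E}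
    (hφ : φ ∈ atlas E M) (v : (p : M) → TangentSpace 𝓘(ℝ, E) p) (η : FormField E M (k + 1)) {y : E}
    (hy : y ∈ φ.target) :
    chartRep φ (interiorField v η) y = (chartRep φ η y).curryLeft (chartVec φ v y) := by
  have hM : IsManifold 𝓘(ℝ, E) 1 M := inferInstance
  have h1 : MDifferentiableAt 𝓘(ℝ, E) 𝓘(ℝ, E) φ.symm y := mdifferentiableAt_atlas_symm hφ hy
  have h2 : MDifferentiableAt 𝓘(ℝ, E) 𝓘(ℝ, E) φ (φ.symm y) :=
    mdifferentiableAt_atlas hφ (φ.map_target hy)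
  have h1' : MDifferentiableAt 𝓘(ℝ, E) 𝓘(ℝ, E) φ.symm (φ (φ.symm y)) := by
    rwa [φ.right_inv hy]
  have h3 := h1'.hasMFDerivAt.comp (φ.symm y) h2.hasMFDerivAt
  have h4 : id =ᶠ[𝓝 (φ.symm y)] φ.symm ∘ φ := by
    filter_upwards [φ.open_source.mem_nhds (φ.map_target hy)] with z hz using (φ.left_inv hz).symm
  have h5 := (h3.congr_of_eventuallyEq h4).mfderiv
  rw [mfderiv_id] at h5
  have h6 := DFunLike.congr_fun h5 (v (φ.symm y))
  have key : ∀ z z' : E, z = z' → (mfderiv 𝓘(ℝ, E) 𝓘(ℝ, E) φ.symm z : E →L[ℝ] E) =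
    (mfderiv 𝓘(ℝ, E) 𝓘(ℝ, E) φ.symm z' : E →L[ℝ] E) := by
    rintro z _ rfl; rfl
  let A : E →L[ℝ] E := mfderiv 𝓘(ℝ, E) 𝓘(ℝ, E) φ.symm y
  have h7 : A (chartVec φ v y) = v (φ.symm y) :=
    (congrArg (fun A : E →L[ℝ] E => A (chartVec φ v y)) (key _ _ (φ.right_inv hy)).symm).trans
      h6.symm
  ext w
  refine congrArg (η (φ.symm y)) (funext (Fin.cases ?_ fun i => rfl))
  exact h7.symm

theorem interiorField_mem [IsManifold 𝓘(ℝ, E) ∞ M] {k : ℕ} (v : VField E M)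
    {η : FormField E M (k + 1)} (hη : η ∈ Form E M (k + 1)) :
    interiorField v η ∈ Form E M k := by
  intro φ hφ
  have hL := LinearIsometry.contDiff (𝕜 := ℝ) (n := ∞) (E := E [⋀^Fin (k + 1)]→L[ℝ] ℝ)
    (F := E →L[ℝ] E [⋀^Fin k]→L[ℝ] ℝ) ContinuousAlternatingMap.curryLeftLI
  exact ((hL.comp_contDiffOn (hη φ hφ)).clm_apply (contDiffOn_chartVec hφ v)).congr
    fun y hy => chartRep_interiorField hφ v η hy

/-- The interior product `ι_v : Ω^{k+1}(M) → Ω^k(M)`. -/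
noncomputable def interior [IsManifold 𝓘(ℝ, E) ∞ M] {k : ℕ} (v : VField E M) :
    Form E M (k + 1) →ₗ[ℝ] Form E M k where
  toFun η := ⟨interiorField v η.1, interiorField_mem v η.2⟩
  map_add' _ _ := rfl
  map_smul' _ _ := rfl

theorem interior_add [IsManifold 𝓘(ℝ, E) ∞ M] {k : ℕ} (v w : VField E M) (η : Form E M (k + 1)) :
    interior (v + w) η = interior v η + interior w η :=
  Subtype.ext (funext fun p => ContinuousLinearMap.map_add
    (ContinuousAlternatingMap.curryLeft (E := E) (η.1 p)) (v p) (w p))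

theorem interior_zero [IsManifold 𝓘(ℝ, E) ∞ M] {k : ℕ} (η : Form E M (k + 1)) :
    interior (0 : VField E M) η = 0 :=
  Subtype.ext (funext fun p => ContinuousLinearMap.map_zero
    (ContinuousAlternatingMap.curryLeft (E := E) (η.1 p)))

theorem interior_smul [IsManifold 𝓘(ℝ, E) ∞ M] {k : ℕ} (r : ℝ) (v : VField E M)
    (η : Form E M (k + 1)) : interior (r • v) η = r • interior v η :=
  Subtype.ext (funext fun p => ContinuousLinearMap.map_smul
    (ContinuousAlternatingMap.curryLeft (E := E) (η.1 p)) r (v p))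

/-- `ι(v_1 ∧ ⋯ ∧ v_p) = ι_{v_p} ⋯ ι_{v_1}`. -/
noncomputable def contract [IsManifold 𝓘(ℝ, E) ∞ M] {k : ℕ} :
    (p : ℕ) → (Fin p → VField E M) → (Form E M (k + p) →ₗ[ℝ] Form E M k)
  | 0, _ => LinearMap.id
  | p + 1, v => contract p (fun i => v i.succ) ∘ₗ interior (v 0)

/-! ### De Rham cohomology -/

variable (E M) in
/-- The exact `k`-forms (there are none but `0` in degree `0`). -/
noncomputable def exactForms [IsManifold 𝓘(ℝ, E) ∞ M] : (k : ℕ) → Submodule ℝ (Form E M k)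
  | 0 => ⊥
  | k + 1 => LinearMap.range (extD (E := E) (M := M) k)

/-- `H^k_dR(M)`: closed `k`-forms modulo exact `k`-forms. -/
abbrev DeRhamCohomology (E M : Type*) [NormedAddCommGroup E] [NormedSpace ℝ E] [TopologicalSpace M]
    [ChartedSpace E M] [IsManifold 𝓘(ℝ, E) ∞ M] (k : ℕ) : Type _ :=
  LinearMap.ker (extD (E := E) (M := M) k) ⧸
    (exactForms E M k).submoduleOf (LinearMap.ker (extD (E := E) (M := M) k))

end

/-! ### The Chevalley–Eilenberg complex with trivial real coefficients -/

section ChevalleyEilenberg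

variable {𝔤 : Type*} [LieRing 𝔤] [LieAlgebra ℝ 𝔤] {N : Type*} [AddCommGroup N] [Module ℝ N]

/-- The sum `∑_{1 ≤ a < b ≤ k+2} (-1)^{a+b+1} c([x_a, x_b], x_1, …, x̂_a, …, x̂_b, …, x_{k+2})`.
In terms of zero-based indices we put `a = i + 1`, `b = j + 2` with `0 ≤ i ≤ j ≤ k`, so that
`(-1)^{a+b+1} = (-1)^{i+j}`; after `x_a` has been removed, `x_b` sits in position `j`. -/
def bracketSum {k : ℕ} (c : 𝔤 [⋀^Fin (k + 1)]→ₗ[ℝ] N) (x : Fin (k + 2) → 𝔤) : N :=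
  ∑ i : Fin (k + 1), ∑ j ≥ i, (-1 : ℤ) ^ (i + j : ℕ) •
    c (Matrix.vecCons ⁅x i.castSucc, x j.succ⁆ (j.removeNth (i.castSucc.removeNth x)))

theorem bracketSum_add {k : ℕ} (c c' : 𝔤 [⋀^Fin (k + 1)]→ₗ[ℝ] N) (x : Fin (k + 2) → 𝔤) :
    bracketSum (c + c') x = bracketSum c x + bracketSum c' x := by
  simp only [bracketSum, AlternatingMap.add_apply, smul_add, Finset.sum_add_distrib]

theorem bracketSum_smul {k : ℕ} (r : ℝ) (c : 𝔤 [⋀^Fin (k + 1)]→ₗ[ℝ] N) (x : Fin (k + 2) → 𝔤) :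
    bracketSum (r • c) x = r • bracketSum c x := by
  simp only [bracketSum, AlternatingMap.smul_apply, Finset.smul_sum]
  exact Finset.sum_congr rfl fun i _ => Finset.sum_congr rfl fun j _ => smul_comm _ _ _

theorem exists_alternatingMap_eq_neg_bracketSum {k : ℕ} (c : 𝔤 [⋀^Fin (k + 1)]→ₗ[ℝ] N) :
    ∃ g : 𝔤 [⋀^Fin (k + 2)]→ₗ[ℝ] N, ∀ x, g x = -bracketSum c x := by
  let B : 𝔤 →ₗ[ℝ] 𝔤 →ₗ[ℝ] 𝔤 [⋀^Fin k]→ₗ[ℝ] N :=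
    LinearMap.mk₂ ℝ (fun x y => c.curryLeft ⁅x, y⁆) (by simp) (by simp) (by simp) (by simp)
  refine ⟨-(2⁻¹ : ℝ) • AlternatingMap.alternatizeUncurryFin
    (AlternatingMap.alternatizeUncurryFinLM ∘ₗ B), fun x => ?_⟩
  have h : AlternatingMap.alternatizeUncurryFin (AlternatingMap.alternatizeUncurryFinLM ∘ₗ B) x =
      (2 : ℝ) • bracketSum c x := by
    rw [AlternatingMap.alternatizeUncurryFin_alternatizeUncurryFinLM_comp_apply, bracketSum,
      Finset.smul_sum]
    refine Finset.sum_congr rfl fun i _ => ?_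
    rw [Finset.smul_sum]
    refine Finset.sum_congr rfl fun j _ => ?_
    have h1 : B (x j.succ) (x i.castSucc) = -B (x i.castSucc) (x j.succ) := by
      simp only [B, LinearMap.mk₂_apply]
      rw [← lie_skew, map_neg]
    rw [h1, AlternatingMap.neg_apply, sub_neg_eq_add, ← two_smul ℝ, smul_comm]
    rfl
  rw [AlternatingMap.smul_apply, h, smul_smul]
  norm_num

/-- The Chevalley–Eilenberg cochains `Hom(Λ^k 𝔤, ℝ)`. -/
def CECochain (𝔤 : Type*) [LieRing 𝔤] [LieAlgebra ℝ 𝔤] (k : ℕ) : Type _ := 𝔤 [⋀^Fin k]→ₗ[ℝ] ℝ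

noncomputable instance (k : ℕ) : AddCommGroup (CECochain 𝔤 k) :=
  inferInstanceAs (AddCommGroup (𝔤 [⋀^Fin k]→ₗ[ℝ] ℝ))

noncomputable instance (k : ℕ) : Module ℝ (CECochain 𝔤 k) :=
  inferInstanceAs (Module ℝ (𝔤 [⋀^Fin k]→ₗ[ℝ] ℝ))

/-- The Chevalley–Eilenberg differential
`(δ c)(x_1, …, x_{k+1}) = ∑_{a<b} (-1)^{a+b} c([x_a, x_b], x_1, …, x̂_a, …, x̂_b, …, x_{k+1})`
on `Hom(Λ^k 𝔤, ℝ)`; it vanishes for `k = 0`. -/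
noncomputable def ceD : (k : ℕ) → CECochain 𝔤 k →ₗ[ℝ] CECochain 𝔤 (k + 1)
  | 0 => 0
  | k + 1 =>
    { toFun := fun c =>
        { toFun := fun x => -bracketSum (N := ℝ) c x
          map_update_add' := by
            obtain ⟨g, hg⟩ := exists_alternatingMap_eq_neg_bracketSum (N := ℝ) c
            intro _ x i a b
            rw [← hg, ← hg, ← hg]
            convert g.map_update_add x i a b
          map_update_smul' := by
            obtain ⟨g, hg⟩ := exists_alternatingMap_eq_neg_bracketSum (N := ℝ) c
            intro _ x i a b
            rw [← hg, ← hg]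
            convert g.map_update_smul x i a b
          map_eq_zero_of_eq' := by
            obtain ⟨g, hg⟩ := exists_alternatingMap_eq_neg_bracketSum (N := ℝ) c
            intro x i j hij hne
            rw [← hg]
            exact g.map_eq_zero_of_eq x hij hne }
      map_add' := fun a b => by
        refine AlternatingMap.ext fun x => ?_
        change _ = -bracketSum (N := ℝ) a x + -bracketSum (N := ℝ) b x
        rw [← neg_add]
        exact congrArg Neg.neg (bracketSum_add a b x)
      map_smul' := fun r a => by
        refine AlternatingMap.ext fun x => ?_
        change _ = r • -bracketSum (N := ℝ) a x
        rw [smul_neg]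
        exact congrArg Neg.neg (bracketSum_smul r a x) }

variable (𝔤) in
/-- The Chevalley–Eilenberg coboundaries of degree `k`. -/
noncomputable def ceCoboundaries : (k : ℕ) → Submodule ℝ (CECochain 𝔤 k)
  | 0 => ⊥
  | k + 1 => LinearMap.range (ceD (𝔤 := 𝔤) k)

/-- `H^k_CE(𝔤)`: cocycles modulo coboundaries. -/
abbrev CECohomology (𝔤 : Type*) [LieRing 𝔤] [LieAlgebra ℝ 𝔤] (k : ℕ) : Type _ :=
  LinearMap.ker (ceD (𝔤 := 𝔤) k) ⧸ (ceCoboundaries 𝔤 k).submoduleOf (LinearMap.ker (ceD (𝔤 := 𝔤) k))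

/-! ### `L_∞`-morphisms out of a Lie algebra -/

open Classical in
/-- `(f_k)_{k ≥ 1}` are the structure maps of an `L_∞`-morphism from the Lie algebra `𝔤` (placed in
degree `0`, with zero differential) to the graded vector space `⨁ i, L i` (with all `L i` inside
`T`) with multibrackets `l_p`. The entry `f 0` plays no role.

On the desuspended cofree coalgebras the map `F` with corestriction
`F¹_k = (-1)^{k(k-1)/2} ↓ ∘ f_k ∘ ↑^{⊗k}` has to intertwine the codifferentials, where the codifferential
of the target has corestriction `Q¹_p = (-1)^{p(p-1)/2} ↓ ∘ l_p ∘ ↑^{⊗p}`. Evaluated on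
`↓x_1 ⊙ ⋯ ⊙ ↓x_m` this reads: for all `m ≥ 1`, the sum
`∑_{a<b} (-1)^{a+b+1} f_{m-1}([x_a, x_b], x_1, …, x̂_a, …, x̂_b, …, x_m)` (empty for `m = 1`) equals
`∑_p (1/p!) ∑_{k_1+⋯+k_p=m} ∑_{σ ∈ Sh(k_1,…,k_p)} ± l_p(f_{k_1}(x_{σ(1)}, …), …, f_{k_p}(…, x_{σ(m)}))`
with `± = sgn(σ) (-1)^{p(p-1)/2 + ∑_r (p-r) k_r}`. The sum over `p` and over `k_1 + ⋯ + k_p = m` with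
all `k_r ≥ 1` is the sum over the compositions of `m`, and an unshuffle is a permutation that is
increasing on each block. -/
structure IsLInftyMorphism {T : Type*} [AddCommGroup T] [Module ℝ T] (L : ℤ → Submodule ℝ T)
    (l : (p : ℕ) → (Fin p → T) → T) (f : (k : ℕ) → 𝔤 [⋀^Fin k]→ₗ[ℝ] T) : Prop where
  degree : ∀ k : ℕ, 1 ≤ k → ∀ x, f k x ∈ L (1 - k)
  compat_one : ∀ x : Fin 1 → 𝔤, l 1 (fun _ => f 1 x) = 0
  compat : ∀ (k : ℕ) (x : Fin (k + 2) → 𝔤),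
    bracketSum (f (k + 1)) x =
      ∑ c : Composition (k + 2), ((c.length.factorial : ℝ)⁻¹) •
        ∑ σ ∈ (Finset.univ : Finset (Equiv.Perm (Fin (k + 2)))).filter
            (fun σ => ∀ r, StrictMono fun a => σ (c.embedding r a)),
          (((Equiv.Perm.sign σ : ℤ) : ℝ) * (-1) ^ (c.length * (c.length - 1) / 2 +
              ∑ r : Fin c.length, (c.length - 1 - r) * c.blocksFun r)) •
            l c.length (fun r => f (c.blocksFun r) (fun a => x (σ (c.embedding r a))))

end ChevalleyEilenberg

/-! ### The Lie `n`-algebra `L_∞(M, ω)`, with `n = m + 1` -/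

/-- `ς(k) = -(-1)^{k(k+1)/2}`. -/
noncomputable def varsig (k : ℕ) : ℝ := -(-1) ^ (k * (k + 1) / 2)

section Observables

variable {E M : Type*} [NormedAddCommGroup E] [NormedSpace ℝ E] [TopologicalSpace M]
  [ChartedSpace E M] [IsManifold 𝓘(ℝ, E) ∞ M]

/-- `v` is a Hamiltonian vector field for the `m`-form `α`: `dα = -ι_v ω`. -/
def IsHamiltonianFor {m : ℕ} (ϖ : Form E M (m + 2)) (α : Form E M m) (v : VField E M) : Prop :=
  extD m α = -interior v ϖ

/-- `v` is a Hamiltonian vector field. -/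
def IsHamiltonianVField {m : ℕ} (ϖ : Form E M (m + 2)) (v : VField E M) : Prop :=
  ∃ α : Form E M m, IsHamiltonianFor ϖ α v

/-- The space of Hamiltonian `(n-1)`-forms of an `(n+1)`-form, `n = m + 1`. -/
noncomputable def hamiltonianForms {m : ℕ} (ϖ : Form E M (m + 2)) : Submodule ℝ (Form E M m) where
  carrier := {α | ∃ v, IsHamiltonianFor ϖ α v}
  add_mem' := by
    rintro α β ⟨v, hv⟩ ⟨w, hw⟩
    refine ⟨v + w, ?_⟩
    have h : interior (v + w) ϖ = interior v ϖ + interior w ϖ := interior_add v w ϖ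
    rw [IsHamiltonianFor] at *
    rw [map_add, hv, hw, h, neg_add]
  zero_mem' := ⟨0, by
    have h : interior (0 : VField E M) ϖ = 0 := interior_zero ϖ
    rw [IsHamiltonianFor, map_zero, h, neg_zero]⟩
  smul_mem' := by
    rintro r α ⟨v, hv⟩
    refine ⟨r • v, ?_⟩
    have h : interior (r • v) ϖ = r • interior v ϖ := interior_smul r v ϖ
    rw [IsHamiltonianFor] at *
    rw [map_smul, hv, h, smul_neg]

open Classical in
/-- Some Hamiltonian vector field of a Hamiltonian form. -/
noncomputable def hamVField {m : ℕ} (ϖ : Form E M (m + 2)) (α : Form E M m) : VField E M :=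
  if h : ∃ v, IsHamiltonianFor ϖ α v then h.choose else 0

/-- Families of forms, one of each degree; the graded vector space of observables lives in here. -/
abbrev TotalForm (E M : Type*) [NormedAddCommGroup E] [NormedSpace ℝ E] [TopologicalSpace M]
    [ChartedSpace E M] : Type _ :=
  (k : ℕ) → Form E M k

/-- The degree `i` part of `L_∞(M, ω)`: Hamiltonian `(n-1)`-forms for `i = 0`, all forms of degree
`n - 1 + i` for `1 - n ≤ i < 0`, and zero otherwise. -/
noncomputable def obsDegree {m : ℕ} (ϖ : Form E M (m + 2)) (i : ℤ) : Submodule ℝ (TotalForm E M) where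
  carrier := {α | (∀ k : ℕ, ((k : ℤ) ≠ m + i ∨ m < k) → α k = 0) ∧ α m ∈ hamiltonianForms ϖ}
  add_mem' := by
    rintro α β ⟨h1, h2⟩ ⟨h3, h4⟩
    exact ⟨fun k hk => by rw [Pi.add_apply, h1 k hk, h3 k hk, add_zero], add_mem h2 h4⟩
  zero_mem' := ⟨fun _ _ => rfl, zero_mem _⟩
  smul_mem' := by
    rintro r α ⟨h1, h2⟩
    exact ⟨fun k hk => by rw [Pi.smul_apply, h1 k hk, smul_zero], Submodule.smul_mem _ r h2⟩

/-- `l_1`: the de Rham differential on the forms of degree less than `n - 1 = m`, and zero on the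
Hamiltonian `(n-1)`-forms. -/
noncomputable def obsDiff (m : ℕ) (α : TotalForm E M) : TotalForm E M
  | 0 => 0
  | k + 1 => if k < m then extD k (α k) else 0

/-- The multibrackets of `L_∞(M, ω)`: for `p ≥ 2`, `l_p(α_1, …, α_p) = ς(p) ι(v_1 ∧ ⋯ ∧ v_p) ω`, a form
of degree `n + 1 - p`, if all `α_r` have degree zero, where `v_r` is any Hamiltonian vector field of
`α_r`; and `l_p` vanishes if some `α_r` is of negative degree. -/
noncomputable def obsBracket {m : ℕ} (ϖ : Form E M (m + 2)) :
    (p : ℕ) → (Fin p → TotalForm E M) → TotalForm E M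
  | 0, _ => 0
  | 1, α => obsDiff m (α 0)
  | p + 2, α => fun k =>
      if h : m + 2 = k + (p + 2) then
        varsig (p + 2) • contract (p + 2) (fun r => hamVField ϖ (α r m)) (h ▸ ϖ)
      else 0

end Observables

/-! ### Lie group actions and homotopy moment maps -/

section Action

instance instLEInftyMinSmoothness : ENat.LEInfty (minSmoothness ℝ 3) :=
  ⟨by rw [minSmoothness_of_isRCLikeNormedField]; exact ENat.LEInfty.out⟩

variable {E M F G : Type*} [NormedAddCommGroup E] [NormedSpace ℝ E] [TopologicalSpace M]
  [ChartedSpace E M] [IsManifold 𝓘(ℝ, E) ∞ M]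
  [NormedAddCommGroup F] [NormedSpace ℝ F] [TopologicalSpace G] [ChartedSpace F G] [Group G]
  [LieGroup 𝓘(ℝ, F) ∞ G] [MulAction G M]

/-- `x ↦ v_x|_p = d/dt|_{t=0} exp(-t x) · p`, that is, minus the derivative at `1` of the orbit map
`g ↦ g · p`. -/
noncomputable def fundAt (E F G : Type*) {M : Type*} [NormedAddCommGroup E] [NormedSpace ℝ E]
    [TopologicalSpace M] [ChartedSpace E M] [NormedAddCommGroup F] [NormedSpace ℝ F]
    [TopologicalSpace G] [ChartedSpace F G] [Group G] [MulAction G M] (p : M) :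
    GroupLieAlgebra 𝓘(ℝ, F) G →L[ℝ] TangentSpace 𝓘(ℝ, E) p :=
  (-mfderiv 𝓘(ℝ, F) 𝓘(ℝ, E) (fun g : G => g • p) (1 : G) :
    TangentSpace 𝓘(ℝ, F) (1 : G) →L[ℝ] TangentSpace 𝓘(ℝ, E) ((1 : G) • p))

theorem contMDiff_fundAt [ContMDiffSMul 𝓘(ℝ, F) 𝓘(ℝ, E) ∞ G M] (x : GroupLieAlgebra 𝓘(ℝ, F) G) :
    ContMDiff 𝓘(ℝ, E) 𝓘(ℝ, E).tangent ∞
      (fun p : M => (⟨p, fundAt E F G p x⟩ : TangentBundle 𝓘(ℝ, E) M)) := by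
  have h1 : ContMDiff 𝓘(ℝ, E) 𝓘(ℝ, F).tangent ∞
      (fun _ : M => (⟨1, -x⟩ : TangentBundle 𝓘(ℝ, F) G)) := contMDiff_const
  have h2 : ContMDiff 𝓘(ℝ, E) 𝓘(ℝ, E).tangent ∞
      (fun p : M => (⟨p, 0⟩ : TangentBundle 𝓘(ℝ, E) M)) := Bundle.contMDiff_zeroSection _ _
  have hact : ContMDiff (𝓘(ℝ, F).prod 𝓘(ℝ, E)) 𝓘(ℝ, E) ∞ (fun q : G × M => q.1 • q.2) :=
    ContMDiffSMul.contMDiff_smul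
  have h3 := ContMDiff.contMDiff_tangentMap (m := ∞) hact (by simp)
  have h4 := (h3.comp contMDiff_equivTangentBundleProd_symm).comp (h1.prodMk h2)
  convert h4 using 1
  funext p
  have h5 := mfderiv_prod_eq_add_apply (I := 𝓘(ℝ, F)) (I' := 𝓘(ℝ, E)) (I'' := 𝓘(ℝ, E))
    (f := fun q : G × M => q.1 • q.2) (p := ((1 : G), p)) (v := (-x, 0))
    (hact.mdifferentiableAt (by simp))
  have key : ∀ (q q' : M) (a b : E), q = q' → a = b →
      (⟨q, a⟩ : TangentBundle 𝓘(ℝ, E) M) = ⟨q', b⟩ := by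
    rintro q _ a _ rfl rfl; rfl
  refine key _ _ _ _ (one_smul G p).symm ?_
  refine Eq.trans ?_ h5.symm
  have h6 : (mfderiv 𝓘(ℝ, E) 𝓘(ℝ, E) (fun z : M => (1 : G) • z) p :
      E →L[ℝ] E) 0 = 0 := ContinuousLinearMap.map_zero _
  have h7 : (mfderiv 𝓘(ℝ, F) 𝓘(ℝ, E) (fun g : G => g • p) (1 : G) : F →L[ℝ] E) (-x : F) =
      -(mfderiv 𝓘(ℝ, F) 𝓘(ℝ, E) (fun g : G => g • p) (1 : G) : F →L[ℝ] E) x :=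
    ContinuousLinearMap.map_neg _ _
  refine Eq.trans ?_ (congrArg₂ (fun a b : E => a + b) h7 h6).symm
  exact (add_zero (_ : E)).symm

/-- The fundamental vector field `v_x` of the action. -/
noncomputable def fundVField [ContMDiffSMul 𝓘(ℝ, F) 𝓘(ℝ, E) ∞ G M]
    (x : GroupLieAlgebra 𝓘(ℝ, F) G) : VField E M :=
  ⟨fun p => fundAt E F G p x, contMDiff_fundAt x⟩

/-- The cochain `c_p(x_1, …, x_{n+1}) = (-1)^n ς(n+1) ω_p(v_{x_1}, …, v_{x_{n+1}})`, `n = m + 1`, on the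
Lie algebra of `G`. -/
noncomputable def momentCochain (F G : Type*) [NormedAddCommGroup F] [NormedSpace ℝ F]
    [CompleteSpace F] [TopologicalSpace G] [ChartedSpace F G] [Group G] [LieGroup 𝓘(ℝ, F) ∞ G]
    [MulAction G M] {m : ℕ}
    (ϖ : Form E M (m + 2)) (p : M) :
    CECochain (GroupLieAlgebra 𝓘(ℝ, F) G) (m + 2) :=
  ((-1) ^ (m + 1) * varsig (m + 2)) •
    (ϖ.1 p).toAlternatingMap.compLinearMap (fundAt E F G p).toLinearMap

/-- A homotopy moment map: an `L_∞`-morphism from the Lie algebra of `G` to `L_∞(M, ω)` with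
`d(f_1(x)) = -ι_{v_x} ω` for all `x`. -/
structure IsHomotopyMomentMap [CompleteSpace F] [ContMDiffSMul 𝓘(ℝ, F) 𝓘(ℝ, E) ∞ G M] {m : ℕ}
    (ϖ : Form E M (m + 2))
    (f : (k : ℕ) → GroupLieAlgebra 𝓘(ℝ, F) G [⋀^Fin k]→ₗ[ℝ] TotalForm E M) : Prop where
  isLInftyMorphism : IsLInftyMorphism (obsDegree ϖ) (obsBracket ϖ) f
  lift : ∀ x, IsHamiltonianFor ϖ (f 1 ![x] m) (fundVField x)

end Action

end HomotopyMoment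

open HomotopyMoment

/-! Write `n = m + 1`, let `δ` be the operator `bracketOp` (minus the Chevalley–Eilenberg
differential), and put `A_k(x_1, …, x_k) = ι_{x_1} ⋯ ι_{x_k} ω`, where `ι_x` is contraction with
`v_x`. A multibracket of arity at least two vanishes once an argument has negative degree. In the
morphism equation only the one-block composition and the composition into singletons therefore
survive (`sum_composition_eq`). What remains to be solved is `δ f_k = d f_{k+1} + (-1)^k A_{k+1}`,
with `f_0 = 0` and `f_k` valued in forms of degree `m + 1 - k`; the equation for `k = 0` says that
`f_1` lifts the action.

The obstruction at each stage is closed. Since `ω` is closed and each `ι_x ω` is exact, `ω` is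
invariant. Since `x ↦ v_x` preserves brackets (`isLieBracket_fundVField`), one has `[L_x, ι_y] =
ι_{[x,y]}` (`interior_commutator`). Together these give `d A_{k+1} = δ A_k`
(`comp_iterContraction_eq_bracketOp`), and with `δ² = 0` the form `δ f_{k+1} + (-1)^k A_{k+2}` is
closed whenever the preceding equation holds. Its degree is `m - k`. As long as this is positive,
the vanishing of de Rham cohomology provides a primitive, chosen linearly (`exists_primitive`), and
this primitive is `f_{k+2}`.

For `k = m` the obstruction is a closed function, hence constant because `M` is connected
(`eq_constForm_of_extD_eq_zero`). Evaluated at `p` it is `δ` of the value of `f_{m+1}` at `p`, plus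
a sign times `ω_p(v_{x_1}, …)`. The latter is a coboundary by hypothesis, so adding a
constant-valued cochain to `f_{m+1}` removes the obstruction. The other equations are unaffected,
because constants are closed (`exists_components`). The corrected component is `f_1` exactly when `n
= 1`. -/

namespace HomotopyMoment

/-! ### The Chevalley–Eilenberg calculus with trivial coefficients -/

section AlternatingCalculus

variable {V N N' : Type*} [AddCommGroup V] [Module ℝ V] [AddCommGroup N] [Module ℝ N]
  [AddCommGroup N'] [Module ℝ N']

/-- The derivation of alternating maps extending an endomorphism `A`:
`(A · c)(x_1, …, x_k) = ∑ j, c(x_1, …, A x_j, …, x_k)`. -/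
noncomputable def derivAct (A : V →ₗ[ℝ] V) :
    {k : ℕ} → (V [⋀^Fin k]→ₗ[ℝ] N) → V [⋀^Fin k]→ₗ[ℝ] N
  | 0, _ => 0
  | _ + 1, c => AlternatingMap.alternatizeUncurryFin (c.curryLeft ∘ₗ A)

theorem derivAct_apply (A : V →ₗ[ℝ] V) {k : ℕ} (c : V [⋀^Fin k]→ₗ[ℝ] N) (x : Fin k → V) :
    derivAct A c x = ∑ j, c (Function.update x j (A (x j))) := by
  cases k with
  | zero => simp [derivAct]
  | succ k =>
    simp only [derivAct, AlternatingMap.alternatizeUncurryFin_apply]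
    refine Finset.sum_congr rfl fun j _ => ?_
    have h := c.neg_one_pow_smul_map_insertNth j (A (x j)) (j.removeNth x)
    rw [Fin.insertNth_removeNth] at h
    have h2 : c (Function.update x j (A (x j))) =
        ((-1 : ℤ) ^ (j : ℕ)) • c (Matrix.vecCons (A (x j)) (j.removeNth x)) := by
      rw [← h, smul_smul, ← mul_pow]; simp
    rw [h2]
    rfl

theorem map_vecCons_vecCons_swap {k : ℕ} (c : V [⋀^Fin (k + 2)]→ₗ[ℝ] N) (a b : V) (x : Fin k → V) :
    c (Matrix.vecCons a (Matrix.vecCons b x)) = -c (Matrix.vecCons b (Matrix.vecCons a x)) := by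
  rw [← c.map_swap _ (show (0 : Fin (k + 2)) ≠ 1 by simp)]
  congr 1
  funext i
  refine Fin.cases ?_ (fun i => Fin.cases ?_ (fun i => ?_) i) i
  · simp
  · rw [Fin.succ_zero_eq_one']; simp
  · rw [Function.comp_apply, Equiv.swap_apply_of_ne_of_ne (by simp) (by simp [Fin.ext_iff])]
    simp

theorem removeNth_succ_vecCons {α : Type*} {k : ℕ} (j : Fin (k + 1)) (a : α) (x : Fin (k + 1) → α) :
    j.succ.removeNth (Matrix.vecCons a x) = Matrix.vecCons a (j.removeNth x) := by
  funext i
  refine Fin.cases ?_ (fun i => ?_) i <;> simp [Fin.removeNth]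

/-- Reduces an identity between alternating maps to its contractions, so that the identities of the
calculus can be proved by induction on the degree. -/
theorem alternatingMap_ext_curryLeft {k : ℕ} {c c' : V [⋀^Fin (k + 1)]→ₗ[ℝ] N}
    (h : ∀ a, c.curryLeft a = c'.curryLeft a) : c = c' := by
  ext x
  have := congrArg (fun d => d (Fin.tail x)) (h (x 0))
  simpa [AlternatingMap.curryLeft_apply_apply, Matrix.vecCons] using this

theorem curryLeft_derivAct (A : V →ₗ[ℝ] V) {k : ℕ} (c : V [⋀^Fin (k + 1)]→ₗ[ℝ] N) (b : V) :
    (derivAct A c).curryLeft b = c.curryLeft (A b) + derivAct A (c.curryLeft b) := by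
  ext x
  rw [AlternatingMap.curryLeft_apply_apply, derivAct_apply, Fin.sum_univ_succ,
    AlternatingMap.add_apply, derivAct_apply]
  congr 1
  · simp [Matrix.vecCons, Fin.update_cons_zero]
  · refine Finset.sum_congr rfl fun j _ => ?_
    simp [Matrix.vecCons, Fin.cons_update]

theorem derivAct_add (A : V →ₗ[ℝ] V) {k : ℕ} (c c' : V [⋀^Fin k]→ₗ[ℝ] N) :
    derivAct A (c + c') = derivAct A c + derivAct A c' := by
  ext x; simp [derivAct_apply, Finset.sum_add_distrib]

theorem derivAct_neg (A : V →ₗ[ℝ] V) {k : ℕ} (c : V [⋀^Fin k]→ₗ[ℝ] N) :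
    derivAct A (-c) = -derivAct A c := by
  ext x; simp [derivAct_apply]

theorem derivAct_sub (A : V →ₗ[ℝ] V) {k : ℕ} (c c' : V [⋀^Fin k]→ₗ[ℝ] N) :
    derivAct A (c - c') = derivAct A c - derivAct A c' := by
  rw [sub_eq_add_neg, derivAct_add, derivAct_neg, ← sub_eq_add_neg]

theorem derivAct_compAlternatingMap (A : V →ₗ[ℝ] V) (g : N →ₗ[ℝ] N') {k : ℕ}
    (c : V [⋀^Fin k]→ₗ[ℝ] N) :
    derivAct A (g.compAlternatingMap c) = g.compAlternatingMap (derivAct A c) := by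
  ext x; simp [derivAct_apply, map_sum]

variable {𝔤 : Type*} [LieRing 𝔤] [LieAlgebra ℝ 𝔤]

/-- `bracketSum`, as an operator on alternating maps (zero in degree zero). -/
noncomputable def bracketOp : {k : ℕ} → (𝔤 [⋀^Fin k]→ₗ[ℝ] N) → 𝔤 [⋀^Fin (k + 1)]→ₗ[ℝ] N
  | 0, _ => 0
  | _ + 1, c => -(exists_alternatingMap_eq_neg_bracketSum c).choose

theorem bracketOp_zero (c : 𝔤 [⋀^Fin 0]→ₗ[ℝ] N) : bracketOp c = 0 := rfl

theorem bracketOp_apply {k : ℕ} (c : 𝔤 [⋀^Fin (k + 1)]→ₗ[ℝ] N) (x : Fin (k + 2) → 𝔤) :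
    bracketOp c x = bracketSum c x := by
  rw [bracketOp, AlternatingMap.neg_apply,
    (exists_alternatingMap_eq_neg_bracketSum c).choose_spec x, neg_neg]

theorem bracketOp_add {k : ℕ} (c c' : 𝔤 [⋀^Fin k]→ₗ[ℝ] N) :
    bracketOp (c + c') = bracketOp c + bracketOp c' := by
  cases k with
  | zero => simp [bracketOp_zero]
  | succ k => ext x; simp [bracketOp_apply, bracketSum_add]

theorem bracketOp_smul {k : ℕ} (r : ℝ) (c : 𝔤 [⋀^Fin k]→ₗ[ℝ] N) :
    bracketOp (r • c) = r • bracketOp c := by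
  cases k with
  | zero => simp [bracketOp_zero]
  | succ k => ext x; simp [bracketOp_apply, bracketSum_smul]

theorem bracketOp_neg {k : ℕ} (c : 𝔤 [⋀^Fin k]→ₗ[ℝ] N) : bracketOp (-c) = -bracketOp c := by
  simpa using bracketOp_smul (-1) c

theorem bracketOp_sub {k : ℕ} (c c' : 𝔤 [⋀^Fin k]→ₗ[ℝ] N) :
    bracketOp (c - c') = bracketOp c - bracketOp c' := by
  rw [sub_eq_add_neg, bracketOp_add, bracketOp_neg, ← sub_eq_add_neg]

theorem bracketOp_compAlternatingMap (g : N →ₗ[ℝ] N') {k : ℕ} (c : 𝔤 [⋀^Fin k]→ₗ[ℝ] N) :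
    bracketOp (g.compAlternatingMap c) = g.compAlternatingMap (bracketOp c) := by
  cases k with
  | zero => ext x; simp [bracketOp_zero]
  | succ k => ext x; simp [bracketOp_apply, bracketSum, map_sum]

/-- The adjoint action as a linear map. -/
abbrev adL (a : 𝔤) : 𝔤 →ₗ[ℝ] 𝔤 := LieAlgebra.ad ℝ 𝔤 a

/-- Cartan's formula. -/
theorem curryLeft_bracketOp {k : ℕ} (c : 𝔤 [⋀^Fin (k + 1)]→ₗ[ℝ] N) (a : 𝔤) :
    (bracketOp c).curryLeft a = derivAct (adL a) c - bracketOp (c.curryLeft a) := by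
  ext x
  rw [AlternatingMap.curryLeft_apply_apply, bracketOp_apply, bracketSum, Fin.sum_univ_succ,
    AlternatingMap.sub_apply, sub_eq_add_neg]
  congr 1
  -- The pairs containing the contracted vector `a` make up the derivation `ad a`; the remaining
  -- pairs make up the bracket sum of the contraction.
  · simp only [derivAct, AlternatingMap.alternatizeUncurryFin_apply]
    refine Finset.sum_congr (by ext; simp) fun j _ => ?_
    simp [Matrix.vecCons, adL]
  · cases k with
    | zero => simp [bracketOp_zero]
    | succ k =>
      rw [bracketOp_apply, bracketSum, ← Finset.sum_neg_distrib]
      refine Finset.sum_congr rfl fun i _ => ?_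
      rw [← Finset.sum_neg_distrib]
      have : Finset.Ici i.succ = (Finset.Ici i).map (Fin.succEmb _) := by
        ext j; refine Fin.cases ?_ (fun j => ?_) j <;> simp
      rw [this, Finset.sum_map]
      refine Finset.sum_congr rfl fun j _ => ?_
      -- The index shift raises the exponent of the sign by two. The minus sign comes from moving
      -- `a` past `[x_i, x_j]` into the first slot.
      rw [← Fin.succ_castSucc, Fin.coe_succEmb, removeNth_succ_vecCons, removeNth_succ_vecCons,
        map_vecCons_vecCons_swap, smul_neg, AlternatingMap.curryLeft_apply_apply]
      congr 2
      simp only [Fin.val_succ]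
      ring

/-- The minus sign is there because endomorphisms act on cochains by precomposition, which reverses
commutators. After one contraction the induction step is the Jacobi identity. -/
theorem derivAct_lie {k : ℕ} (c : 𝔤 [⋀^Fin k]→ₗ[ℝ] N) (a b : 𝔤) :
    derivAct (adL a) (derivAct (adL b) c) - derivAct (adL b) (derivAct (adL a) c) =
      -derivAct (adL ⁅a, b⁆) c := by
  induction k with
  | zero => simp [derivAct]
  | succ k ih =>
    refine alternatingMap_ext_curryLeft fun d => ?_
    have h := ih (c.curryLeft d)
    have hs : ∀ (e f : 𝔤 [⋀^Fin (k+1)]→ₗ[ℝ] N), (e - f).curryLeft d = e.curryLeft d - f.curryLeft d :=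
      fun _ _ => rfl
    have hn : ∀ (e : 𝔤 [⋀^Fin (k+1)]→ₗ[ℝ] N), (-e).curryLeft d = -e.curryLeft d :=
      fun _ => rfl
    have hj : c.curryLeft (adL b (adL a d)) =
        c.curryLeft (adL a (adL b d)) - c.curryLeft (adL ⁅a, b⁆ d) := by
      rw [← map_sub]; simp [adL]
    rw [hs, hn]
    simp only [curryLeft_derivAct, derivAct_add]
    rw [sub_eq_iff_eq_add] at h
    rw [h, hj]
    abel

/-- Cartan's formula moves a contraction past both operators; the discrepancy is then the commutator
of two derivations, given by `derivAct_lie`. -/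
theorem bracketOp_derivAct {k : ℕ} (c : 𝔤 [⋀^Fin k]→ₗ[ℝ] N) (a : 𝔤) :
    bracketOp (derivAct (adL a) c) = derivAct (adL a) (bracketOp c) := by
  induction k with
  | zero => ext x; simp [bracketOp_zero, derivAct_apply]
  | succ k ih =>
    refine alternatingMap_ext_curryLeft fun b => ?_
    rw [curryLeft_bracketOp, curryLeft_derivAct, curryLeft_derivAct, curryLeft_bracketOp,
      curryLeft_bracketOp, bracketOp_add, ih, derivAct_sub]
    have h := derivAct_lie c a b
    rw [sub_eq_iff_eq_add] at h
    rw [h]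
    have : adL a b = ⁅a, b⁆ := rfl
    rw [this]
    abel

/-- By Cartan's formula used twice, `ι_b δ² = L_b δ - δ L_b + δ² ι_b`. The first two terms cancel,
and the last vanishes by induction. -/
theorem bracketOp_bracketOp {k : ℕ} (c : 𝔤 [⋀^Fin k]→ₗ[ℝ] N) : bracketOp (bracketOp c) = 0 := by
  induction k with
  | zero => ext x; simp [bracketOp_zero, bracketOp_apply, bracketSum]
  | succ k ih =>
    refine alternatingMap_ext_curryLeft fun b => ?_
    rw [curryLeft_bracketOp, curryLeft_bracketOp, bracketOp_sub, ih, bracketOp_derivAct]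
    simp

end AlternatingCalculus

/-! ### Iterated contractions in a Cartan calculus -/

section IteratedContraction

variable {V T : Type*} [AddCommGroup V] [Module ℝ V] [AddCommGroup T] [Module ℝ T]

/-- For operators `I a` with `I a ∘ I a = 0`, the alternating map
`(x_1, …, x_k) ↦ I x_1 (I x_2 (⋯ (I x_k ϖ)))`. -/
noncomputable def iterContraction (I : V →ₗ[ℝ] Module.End ℝ T) (hI : ∀ a, I a * I a = 0)
    (k : ℕ) (ϖ : T) : V [⋀^Fin k]→ₗ[ℝ] T :=
  (LinearMap.applyₗ ϖ ∘ₗ (ExteriorAlgebra.lift ℝ ⟨I, hI⟩).toLinearMap).compAlternatingMap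
    (ExteriorAlgebra.ιMulti ℝ k)

variable (I : V →ₗ[ℝ] Module.End ℝ T) (hI : ∀ a, I a * I a = 0)

theorem iterContraction_zero (ϖ : T) (x : Fin 0 → V) : iterContraction I hI 0 ϖ x = ϖ := by
  simp [iterContraction]

theorem iterContraction_vecCons {k : ℕ} (ϖ : T) (a : V) (x : Fin k → V) :
    iterContraction I hI (k + 1) ϖ (Matrix.vecCons a x) = I a (iterContraction I hI k ϖ x) := by
  simp [iterContraction, ExteriorAlgebra.ιMulti_succ_apply, Matrix.vecTail, Function.comp_def]

theorem iterContraction_succ {k : ℕ} (ϖ : T) (x : Fin (k + 1) → V) :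
    iterContraction I hI (k + 1) ϖ x = I (x 0) (iterContraction I hI k ϖ (Fin.tail x)) := by
  rw [← iterContraction_vecCons, Matrix.vecCons, Fin.cons_self_tail]

theorem curryLeft_iterContraction {k : ℕ} (ϖ : T) (a : V) :
    (iterContraction I hI (k + 1) ϖ).curryLeft a = (I a).compAlternatingMap (iterContraction I hI k ϖ) := by
  ext x
  simp [iterContraction_vecCons]

variable {𝔤 : Type*} [LieRing 𝔤] [LieAlgebra ℝ 𝔤] {J : 𝔤 →ₗ[ℝ] Module.End ℝ T}
  (hJ : ∀ a, J a * J a = 0) {D : Module.End ℝ T}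

/-- Iterated contractions of an invariant element are equivariant. -/
theorem lieDeriv_comp_iterContraction
    (hbr : ∀ a b η, D (J a (J b η)) + J a (D (J b η)) - J b (D (J a η)) - J b (J a (D η)) =
      J ⁅a, b⁆ η)
    {ϖ : T} (h0 : D ϖ = 0) (h1 : ∀ a, D (J a ϖ) = 0) (a : 𝔤) (k : ℕ) :
    (D * J a + J a * D).compAlternatingMap (iterContraction J hJ k ϖ) =
      derivAct (adL a) (iterContraction J hJ k ϖ) := by
  induction k with
  | zero => ext x; simp [iterContraction_zero, h0, h1, derivAct]
  | succ k ih =>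
    refine alternatingMap_ext_curryLeft fun b => ?_
    rw [curryLeft_derivAct, curryLeft_iterContraction, curryLeft_iterContraction,
      derivAct_compAlternatingMap, ← ih]
    ext x
    -- With `L_a = D J_a + J_a D`, this is `[L_a, J_b] = J_{[a,b]}`: commuting `L_a` past one
    -- contraction yields one term of the derivation.
    have h := hbr a b (iterContraction J hJ k ϖ x)
    have h2 : adL a b = ⁅a, b⁆ := rfl
    simp only [AlternatingMap.curryLeft_apply_apply, LinearMap.compAlternatingMap_apply,
      iterContraction_vecCons, LinearMap.add_apply, Module.End.mul_apply, AlternatingMap.add_apply,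
      h2, ← h, map_add]
    abel

/-- The differential of the iterated contractions of a closed invariant element. -/
theorem comp_iterContraction_eq_bracketOp
    (hbr : ∀ a b η, D (J a (J b η)) + J a (D (J b η)) - J b (D (J a η)) - J b (J a (D η)) =
      J ⁅a, b⁆ η)
    {ϖ : T} (h0 : D ϖ = 0) (h1 : ∀ a, D (J a ϖ) = 0) (k : ℕ) :
    D.compAlternatingMap (iterContraction J hJ (k + 1) ϖ) =
      bracketOp (iterContraction J hJ k ϖ) := by
  induction k with
  | zero => ext x; simp [iterContraction_succ, iterContraction_zero, bracketOp_zero, h1]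
  | succ k ih =>
    refine alternatingMap_ext_curryLeft fun a => ?_
    -- Both sides obey the same recursion: `D J_a = L_a - J_a D` on one side and Cartan's formula
    -- for `bracketOp` on the other. Equivariance identifies the two Lie derivatives.
    rw [curryLeft_bracketOp, curryLeft_iterContraction, bracketOp_compAlternatingMap, ← ih,
      ← lieDeriv_comp_iterContraction hJ hbr h0 h1]
    ext x
    simp [iterContraction_vecCons]

variable (J) in
/-- The recursively defined components `f_k` with `f_0 = 0`, `f_1 = φ` and
`f_k = P ∘ (bracketOp f_{k-1} + (-1)^k A_k)`, where `P` is a primitive operator and `A_k` the iterated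
contractions. -/
noncomputable def momentSeq (P : Module.End ℝ T) (φ : 𝔤 [⋀^Fin 1]→ₗ[ℝ] T) (ϖ : T) :
    (k : ℕ) → 𝔤 [⋀^Fin k]→ₗ[ℝ] T
  | 0 => 0
  | 1 => φ
  | k + 2 => P.compAlternatingMap
      (bracketOp (momentSeq P φ ϖ (k + 1)) + (-1 : ℝ) ^ k • iterContraction J hJ (k + 2) ϖ)

/-- If the equation for `f_{k+1}` holds, then the right-hand side for `f_{k+2}` is closed. -/
theorem comp_bracketOp_add_iterContraction_eq_zero
    (hbr : ∀ a b η, D (J a (J b η)) + J a (D (J b η)) - J b (D (J a η)) - J b (J a (D η)) =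
      J ⁅a, b⁆ η)
    {ϖ : T} (h0 : D ϖ = 0) (h1 : ∀ a, D (J a ϖ) = 0) {k : ℕ} {f : 𝔤 [⋀^Fin k]→ₗ[ℝ] T}
    {g : 𝔤 [⋀^Fin (k + 1)]→ₗ[ℝ] T}
    (h : D.compAlternatingMap g = bracketOp f - (-1 : ℝ) ^ k • iterContraction J hJ (k + 1) ϖ) :
    D.compAlternatingMap
      (bracketOp g + (-1 : ℝ) ^ k • iterContraction J hJ (k + 2) ϖ) = 0 := by
  have e : D.compAlternatingMap
      (bracketOp g + (-1 : ℝ) ^ k • iterContraction J hJ (k + 2) ϖ) =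
      D.compAlternatingMap (bracketOp g) +
        (-1 : ℝ) ^ k • D.compAlternatingMap (iterContraction J hJ (k + 2) ϖ) := by
    ext x; simp
  rw [e, ← bracketOp_compAlternatingMap, h, bracketOp_sub, bracketOp_bracketOp, bracketOp_smul,
    comp_iterContraction_eq_bracketOp hJ hbr h0 h1]
  simp

end IteratedContraction

/-! ### Cartan calculus on a normed space -/

section LocalCartan

variable {E F : Type*} [NormedAddCommGroup E] [NormedSpace ℝ E] [NormedAddCommGroup F]
  [NormedSpace ℝ F]

theorem hasFDerivAt_curryLeft {k : ℕ} {η : E → E [⋀^Fin (k + 1)]→L[ℝ] ℝ} {X : E → E} {y : E}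
    (hη : DifferentiableAt ℝ η y) (hX : DifferentiableAt ℝ X y) :
    ∃ L : E →L[ℝ] E [⋀^Fin k]→L[ℝ] ℝ, HasFDerivAt (fun z => (η z).curryLeft (X z)) L y ∧
      ∀ u, L u = (η y).curryLeft (fderiv ℝ X y u) + (fderiv ℝ η y u).curryLeft (X y) := by
  have h0 := ContinuousLinearMap.hasFDerivAt (x := η y) (ContinuousAlternatingMap.curryLeftLI
    (𝕜 := ℝ) (E := E) (F := ℝ) (n := k)).toContinuousLinearMap
  have h1 := HasFDerivAt.comp (𝕜 := ℝ) (f := η) (G := E →L[ℝ] E [⋀^Fin k]→L[ℝ] ℝ)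
    (g := fun ζ => ζ.curryLeft) y h0 hη.hasFDerivAt
  have h2 := h1.clm_apply hX.hasFDerivAt
  exact ⟨_, h2, fun u => rfl⟩

theorem extDeriv_apply_eq_sum {k : ℕ} (η : E → E [⋀^Fin k]→L[ℝ] ℝ) (y : E) (u : Fin (k + 1) → E) :
    extDeriv η y u = ∑ i : Fin (k + 1), (-1 : ℤ) ^ (i : ℕ) • fderiv ℝ η y (u i) (i.removeNth u) := by
  simp [extDeriv, ContinuousAlternatingMap.alternatizeUncurryFin_apply]

/-- The Lie derivative of a form of degree zero. -/
theorem extDeriv_curryLeft_zero (η : E → E [⋀^Fin 0]→L[ℝ] ℝ) (y v : E) (u : Fin 0 → E) :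
    extDeriv η y (Matrix.vecCons v u) = fderiv ℝ η y v u := by
  rw [extDeriv_apply_eq_sum]
  simp

/-- The Lie derivative of a form of positive degree. -/
theorem extDeriv_curryLeft_add {k : ℕ} {η : E → E [⋀^Fin (k + 1)]→L[ℝ] ℝ} {X : E → E} {y : E}
    (hη : DifferentiableAt ℝ η y) (hX : DifferentiableAt ℝ X y) (u : Fin (k + 1) → E) :
    extDeriv (fun z => (η z).curryLeft (X z)) y u + extDeriv η y (Matrix.vecCons (X y) u) =
      fderiv ℝ η y (X y) u +
        derivAct (fderiv ℝ X y : E →ₗ[ℝ] E) (η y).toAlternatingMap u := by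
  obtain ⟨L, hL, hLu⟩ := hasFDerivAt_curryLeft hη hX
  have h : ∀ j : Fin (k + 1), (-1 : ℤ) ^ (j.succ : ℕ) • fderiv ℝ η y (Matrix.vecCons (X y) u j.succ)
      (j.succ.removeNth (Matrix.vecCons (X y) u)) =
      -((-1 : ℤ) ^ (j : ℕ) • fderiv ℝ η y (u j) (Matrix.vecCons (X y) (j.removeNth u))) := by
    intro j
    rw [removeNth_succ_vecCons, Fin.val_succ, pow_succ, mul_neg_one, neg_smul, Matrix.cons_val_succ]
  rw [extDeriv_apply_eq_sum η, Fin.sum_univ_succ, Finset.sum_congr rfl fun j _ => h j,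
    extDeriv_apply_eq_sum, hL.fderiv]
  simp only [hLu, derivAct, AlternatingMap.alternatizeUncurryFin_apply,
    ContinuousAlternatingMap.add_apply, smul_add,
    Finset.sum_add_distrib, ContinuousAlternatingMap.curryLeft_apply_apply, Finset.sum_neg_distrib]
  have h0 : (0 : Fin (k + 2)).removeNth (Matrix.vecCons (X y) u) = u := rfl
  rw [h0, Matrix.cons_val_zero, Fin.val_zero, pow_zero, one_smul]
  have h5 : ∀ j, AlternatingMap.curryLeft (η y).toAlternatingMap (fderiv ℝ X y (u j))
    (j.removeNth u) = η y (Matrix.vecCons (fderiv ℝ X y (u j)) (j.removeNth u)) := fun _ => rfl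
  simp only [LinearMap.comp_apply, ContinuousLinearMap.coe_coe, h5]
  abel

/-- This is `[L_X, ι_Y] = ι_{[X,Y]}` with `L = dι + ιd` written out. By `extDeriv_curryLeft_add`,
`L_X` is a directional derivative plus the derivation by `DX`. The derivatives of `η` cancel,
leaving `η` contracted with `DY(X) - DX(Y)`. -/
theorem extDeriv_curryLeft_commutator {k : ℕ} {η : E → E [⋀^Fin (k + 2)]→L[ℝ] ℝ} {X Y : E → E}
    {y : E} (hη : DifferentiableAt ℝ η y) (hX : DifferentiableAt ℝ X y)
    (hY : DifferentiableAt ℝ Y y) (u : Fin (k + 1) → E) :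
    extDeriv (fun z => ((η z).curryLeft (Y z)).curryLeft (X z)) y u +
      extDeriv (fun z => (η z).curryLeft (Y z)) y (Matrix.vecCons (X y) u) -
      extDeriv (fun z => (η z).curryLeft (X z)) y (Matrix.vecCons (Y y) u) -
      extDeriv η y (Matrix.vecCons (X y) (Matrix.vecCons (Y y) u)) =
    η y (Matrix.vecCons (VectorField.lieBracket ℝ X Y y) u) := by
  obtain ⟨L, hL, hLu⟩ := hasFDerivAt_curryLeft hη hY
  have h1 := extDeriv_curryLeft_add hL.differentiableAt hX u
  have h2 := extDeriv_curryLeft_add hη hX (Matrix.vecCons (Y y) u)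
  rw [h1, sub_sub, h2, hL.fderiv, hLu]
  have h3 := congrArg (fun d => d u) (curryLeft_derivAct (fderiv ℝ X y : E →ₗ[ℝ] E)
    (η y).toAlternatingMap (Y y))
  simp only [AlternatingMap.curryLeft_apply_apply, AlternatingMap.add_apply] at h3
  rw [h3]
  have h4 : ((η y).curryLeft (Y y)).toAlternatingMap = (η y).toAlternatingMap.curryLeft (Y y) := rfl
  rw [h4, VectorField.lieBracket]
  have h5 : ∀ a : E, (η y).toAlternatingMap (Matrix.vecCons a u) = (η y).curryLeft a u := fun _ => rfl
  have h6 : ∀ a : E, η y (Matrix.vecCons a u) = (η y).curryLeft a u := fun _ => rfl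
  rw [h6, h5, map_sub]
  simp only [ContinuousAlternatingMap.add_apply, ContinuousAlternatingMap.sub_apply,
    ContinuousAlternatingMap.curryLeft_apply_apply, ContinuousLinearMap.coe_coe]
  ring

/-- The one-form case is separate because the double contraction would have degree `-1`, so its term
is absent. -/
theorem extDeriv_curryLeft_commutator_one {η : E → E [⋀^Fin 1]→L[ℝ] ℝ} {X Y : E → E}
    {y : E} (hη : DifferentiableAt ℝ η y) (hX : DifferentiableAt ℝ X y)
    (hY : DifferentiableAt ℝ Y y) (u : Fin 0 → E) :
      extDeriv (fun z => (η z).curryLeft (Y z)) y (Matrix.vecCons (X y) u) -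
      extDeriv (fun z => (η z).curryLeft (X z)) y (Matrix.vecCons (Y y) u) -
      extDeriv η y (Matrix.vecCons (X y) (Matrix.vecCons (Y y) u)) =
    η y (Matrix.vecCons (VectorField.lieBracket ℝ X Y y) u) := by
  obtain ⟨L, hL, hLu⟩ := hasFDerivAt_curryLeft hη hY
  have h2 := extDeriv_curryLeft_add hη hX (Matrix.vecCons (Y y) u)
  rw [sub_sub, h2, extDeriv_curryLeft_zero, hL.fderiv, hLu]
  have h3 := congrArg (fun d => d u) (curryLeft_derivAct (fderiv ℝ X y : E →ₗ[ℝ] E)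
    (η y).toAlternatingMap (Y y))
  simp only [AlternatingMap.curryLeft_apply_apply, AlternatingMap.add_apply] at h3
  rw [h3, VectorField.lieBracket]
  have h5 : ∀ a : E, (η y).toAlternatingMap (Matrix.vecCons a u) = (η y).curryLeft a u := fun _ => rfl
  have h6 : ∀ a : E, η y (Matrix.vecCons a u) = (η y).curryLeft a u := fun _ => rfl
  rw [h6, h5, map_sub]
  simp only [ContinuousAlternatingMap.add_apply, ContinuousAlternatingMap.sub_apply,
    ContinuousAlternatingMap.curryLeft_apply_apply, ContinuousLinearMap.coe_coe]
  simp only [derivAct, AlternatingMap.zero_apply]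
  ring

/-- Vector fields related by a `C²` map have related Lie brackets. -/
theorem lieBracket_of_related {f : F → E} {X Y : F → F} {V W : E → E} {z : F}
    (hf : ContDiffAt ℝ 2 f z) (hX : DifferentiableAt ℝ X z) (hY : DifferentiableAt ℝ Y z)
    (hV : DifferentiableAt ℝ V (f z)) (hW : DifferentiableAt ℝ W (f z))
    (hXV : ∀ᶠ x in 𝓝 z, V (f x) = fderiv ℝ f x (X x))
    (hYW : ∀ᶠ x in 𝓝 z, W (f x) = fderiv ℝ f x (Y x)) :
    VectorField.lieBracket ℝ V W (f z) = fderiv ℝ f z (VectorField.lieBracket ℝ X Y z) := by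
  have hfd : DifferentiableAt ℝ f z := hf.differentiableAt (by simp)
  -- The `C²` hypothesis enters here: symmetry of the second derivative of `f` makes its
  -- contributions cancel.
  have h := VectorField.fderiv_apply_lieBracket (𝕜 := ℝ) hf (by simp) hY hX
  have hXV' : (fun x => fderiv ℝ f x (X x)) =ᶠ[𝓝 z] V ∘ f := hXV.mono fun x hx => hx.symm
  have hYW' : (fun x => fderiv ℝ f x (Y x)) =ᶠ[𝓝 z] W ∘ f := hYW.mono fun x hx => hx.symm
  rw [h, hXV'.fderiv_eq, hYW'.fderiv_eq, fderiv_comp z hV hfd, fderiv_comp z hW hfd,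
    VectorField.lieBracket, hXV.self_of_nhds, hYW.self_of_nhds]
  rfl

end LocalCartan

/-! ### Cartan calculus on a manifold -/

section ManifoldCartan

variable {E M : Type*} [NormedAddCommGroup E] [NormedSpace ℝ E] [TopologicalSpace M]
  [ChartedSpace E M] [IsManifold 𝓘(ℝ, E) ∞ M]

theorem mfderiv_symm_mfderiv_apply {φ : OpenPartialHomeomorph M E} (hφ : φ ∈ atlas E M) {q : M}
    (hq : q ∈ φ.source) (w : E) :
    (mfderiv 𝓘(ℝ, E) 𝓘(ℝ, E) φ.symm (φ q) : E →L[ℝ] E)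
      ((mfderiv 𝓘(ℝ, E) 𝓘(ℝ, E) φ q : E →L[ℝ] E) w) = w := by
  have hM : IsManifold 𝓘(ℝ, E) 1 M := inferInstance
  have h2 : MDifferentiableAt 𝓘(ℝ, E) 𝓘(ℝ, E) φ q := mdifferentiableAt_atlas hφ hq
  have h1 : MDifferentiableAt 𝓘(ℝ, E) 𝓘(ℝ, E) φ.symm (φ q) :=
    mdifferentiableAt_atlas_symm hφ (φ.map_source hq)
  have h3 := h1.hasMFDerivAt.comp q h2.hasMFDerivAt
  have h4 : id =ᶠ[𝓝 q] φ.symm ∘ φ := by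
    filter_upwards [φ.open_source.mem_nhds hq] with z hz using (φ.left_inv hz).symm
  have h5 := (h3.congr_of_eventuallyEq h4).mfderiv
  rw [mfderiv_id] at h5
  exact (DFunLike.congr_fun h5 w).symm

/-- The differentials of a chart and of its inverse are mutually inverse, so a chart representative
determines the form on the source of the chart. -/
theorem apply_eq_chartRep {k : ℕ} {φ : OpenPartialHomeomorph M E} (hφ : φ ∈ atlas E M)
    (η : FormField E M k) {q : M} (hq : q ∈ φ.source) (w : Fin k → E) :
    (η q : E [⋀^Fin k]→L[ℝ] ℝ) w =
      chartRep φ η (φ q) (fun i => (mfderiv 𝓘(ℝ, E) 𝓘(ℝ, E) φ q : E →L[ℝ] E) (w i)) := by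
  have key : ∀ r r' : M, r = r' → ∀ u : Fin k → E,
      (η r : E [⋀^Fin k]→L[ℝ] ℝ) u = (η r' : E [⋀^Fin k]→L[ℝ] ℝ) u := by
    rintro r _ rfl u; rfl
  have h : w = fun i => (mfderiv 𝓘(ℝ, E) 𝓘(ℝ, E) φ.symm (φ q) : E →L[ℝ] E)
      ((mfderiv 𝓘(ℝ, E) 𝓘(ℝ, E) φ q : E →L[ℝ] E) (w i)) :=
    funext fun i => (mfderiv_symm_mfderiv_apply hφ hq (w i)).symm
  exact (key _ _ (φ.left_inv hq).symm w).trans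
    (congrArg (fun u => (η (φ.symm (φ q)) : E [⋀^Fin k]→L[ℝ] ℝ) u) h)

/-- Forms agree if their representatives in the preferred charts agree. -/
theorem form_ext_chartRep {k : ℕ} {η η' : Form E M k}
    (h : ∀ p : M, chartRep (chartAt E p) η.1 (chartAt E p p) =
      chartRep (chartAt E p) η'.1 (chartAt E p p)) : η = η' := by
  refine Subtype.ext (funext fun p => ?_)
  refine ContinuousAlternatingMap.ext fun w => ?_
  have h1 := apply_eq_chartRep (chart_mem_atlas E p) η.1 (mem_chart_source E p) w
  have h2 := apply_eq_chartRep (chart_mem_atlas E p) η'.1 (mem_chart_source E p) w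
  rw [h p] at h1
  exact h1.trans h2.symm

theorem chartRep_extD {k : ℕ} {φ : OpenPartialHomeomorph M E} (hφ : φ ∈ atlas E M)
    (η : Form E M k) {y : E} (hy : y ∈ φ.target) :
    chartRep φ (extD k η).1 y = extDeriv (chartRep φ η.1) y :=
  chartRep_dField hφ η.2 hy

theorem chartRep_interior {k : ℕ} {φ : OpenPartialHomeomorph M E} (hφ : φ ∈ atlas E M)
    (v : VField E M) (η : Form E M (k + 1)) {y : E} (hy : y ∈ φ.target) :
    chartRep φ (interior v η).1 y = (chartRep φ η.1 y).curryLeft (chartVec φ v y) :=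
  chartRep_interiorField hφ v η.1 hy

theorem chartRep_interior_eventuallyEq {k : ℕ} {φ : OpenPartialHomeomorph M E} (hφ : φ ∈ atlas E M)
    (v : VField E M) (η : Form E M (k + 1)) {y : E} (hy : y ∈ φ.target) :
    chartRep φ (interior v η).1 =ᶠ[𝓝 y]
      fun z => (chartRep φ η.1 z).curryLeft (chartVec φ v z) := by
  filter_upwards [φ.open_target.mem_nhds hy] with z hz using chartRep_interior hφ v η hz

theorem extD_extD {k : ℕ} (η : Form E M k) : extD (k + 1) (extD k η) = 0 := by
  refine form_ext_chartRep fun p => ?_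
  have hφ := chart_mem_atlas E p
  have hy := mem_chart_target E p
  have h : chartRep (chartAt E p) (extD k η).1 =ᶠ[𝓝 (chartAt E p p)]
      extDeriv (chartRep (chartAt E p) η.1) := by
    filter_upwards [(chartAt E p).open_target.mem_nhds hy] with z hz using chartRep_extD hφ η hz
  rw [chartRep_extD hφ _ hy, h.extDeriv_eq,
    extDeriv_extDeriv_apply ((η.2 _ hφ).contDiffAt ((chartAt E p).open_target.mem_nhds hy))
      (by simpa using (ENat.LEInfty.out : (2 : WithTop ℕ∞) ≤ ∞))]
  rfl

theorem interior_interior_self {k : ℕ} (v : VField E M) (η : Form E M (k + 2)) :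
    interior v (interior v η) = 0 := by
  refine Subtype.ext (funext fun p => ?_)
  exact ContinuousAlternatingMap.curryLeft_same (E := E) (η.1 p) (v p)

/-- `u` is the Lie bracket of `v` and `w`. -/
def IsLieBracket (v w u : VField E M) : Prop :=
  ∀ p : M, VectorField.lieBracket ℝ (chartVec (chartAt E p) v) (chartVec (chartAt E p) w)
    (chartAt E p p) = chartVec (chartAt E p) u (chartAt E p p)

theorem differentiableAt_chartVec (v : VField E M) (p : M) :
    DifferentiableAt ℝ (chartVec (chartAt E p) v) (chartAt E p p) :=
  ((contDiffOn_chartVec (chart_mem_atlas E p) v).contDiffAt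
    ((chartAt E p).open_target.mem_nhds (mem_chart_target E p))).differentiableAt (by simp)

/-- In the preferred chart at each point every term has an explicit representative, and the identity
becomes its counterpart on the model space. The bracket is needed only at the centre of the chart.
-/
theorem interior_commutator {k : ℕ} {v w u : VField E M} (h : IsLieBracket v w u)
    (η : Form E M (k + 2)) :
    extD k (interior v (interior w η)) + interior v (extD (k + 1) (interior w η)) -
      interior w (extD (k + 1) (interior v η)) - interior w (interior v (extD (k + 2) η)) =
    interior u η := by
  refine form_ext_chartRep fun p => ContinuousAlternatingMap.ext fun x => ?_
  have hφ := chart_mem_atlas E p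
  have hy := mem_chart_target E p
  set φ := chartAt E p
  set y := φ p
  have hv := differentiableAt_chartVec v p
  have hw := differentiableAt_chartVec w p
  have e1 : chartRep φ (interior v (interior w η)).1 =ᶠ[𝓝 y]
      fun z => ((chartRep φ η.1 z).curryLeft (chartVec φ w z)).curryLeft (chartVec φ v z) := by
    filter_upwards [φ.open_target.mem_nhds hy] with z hz
    rw [chartRep_interior hφ _ _ hz, chartRep_interior hφ _ _ hz]
  have t1 : chartRep φ (extD k (interior v (interior w η))).1 y x =
      extDeriv (fun z => ((chartRep φ η.1 z).curryLeft (chartVec φ w z)).curryLeft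
        (chartVec φ v z)) y x := by
    rw [chartRep_extD hφ _ hy, e1.extDeriv_eq]
  have t2 : ∀ a b : VField E M, chartRep φ (interior a (extD (k + 1) (interior b η))).1 y x =
      extDeriv (fun z => (chartRep φ η.1 z).curryLeft (chartVec φ b z)) y
        (Matrix.vecCons (chartVec φ a y) x) := by
    intro a b
    rw [chartRep_interior hφ _ _ hy, chartRep_extD hφ _ hy,
      (chartRep_interior_eventuallyEq hφ b η hy).extDeriv_eq]
    rfl
  have t3 : chartRep φ (interior w (interior v (extD (k + 2) η))).1 y x =
      extDeriv (chartRep φ η.1) y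
        (Matrix.vecCons (chartVec φ v y) (Matrix.vecCons (chartVec φ w y) x)) := by
    rw [chartRep_interior hφ _ _ hy, chartRep_interior hφ _ _ hy, chartRep_extD hφ _ hy]
    rfl
  have t4 : chartRep φ (interior u η).1 y x =
      chartRep φ η.1 y (Matrix.vecCons (chartVec φ u y) x) := by
    rw [chartRep_interior hφ _ _ hy]
    rfl
  rw [t4, ← h p]
  refine Eq.trans ?_ (extDeriv_curryLeft_commutator (Form.differentiableAt_chartRep η p) hv hw x)
  rw [← t1, ← t2, ← t2, ← t3]
  rfl

theorem interior_commutator_one {v w u : VField E M} (h : IsLieBracket v w u) (η : Form E M 1) :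
    interior v (extD 0 (interior w η)) - interior w (extD 0 (interior v η)) -
      interior w (interior v (extD 1 η)) = interior u η := by
  refine form_ext_chartRep fun p => ContinuousAlternatingMap.ext fun x => ?_
  have hφ := chart_mem_atlas E p
  have hy := mem_chart_target E p
  set φ := chartAt E p
  set y := φ p
  have hv := differentiableAt_chartVec v p
  have hw := differentiableAt_chartVec w p
  have t2 : ∀ a b : VField E M, chartRep φ (interior a (extD 0 (interior b η))).1 y x =
      extDeriv (fun z => (chartRep φ η.1 z).curryLeft (chartVec φ b z)) y
        (Matrix.vecCons (chartVec φ a y) x) := by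
    intro a b
    rw [chartRep_interior hφ _ _ hy, chartRep_extD hφ _ hy,
      (chartRep_interior_eventuallyEq hφ b η hy).extDeriv_eq]
    rfl
  have t3 : chartRep φ (interior w (interior v (extD 1 η))).1 y x =
      extDeriv (chartRep φ η.1) y
        (Matrix.vecCons (chartVec φ v y) (Matrix.vecCons (chartVec φ w y) x)) := by
    rw [chartRep_interior hφ _ _ hy, chartRep_interior hφ _ _ hy, chartRep_extD hφ _ hy]
    rfl
  have t4 : chartRep φ (interior u η).1 y x =
      chartRep φ η.1 y (Matrix.vecCons (chartVec φ u y) x) := by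
    rw [chartRep_interior hφ _ _ hy]
    rfl
  rw [t4, ← h p]
  refine Eq.trans ?_ (extDeriv_curryLeft_commutator_one (Form.differentiableAt_chartRep η p) hv hw x)
  rw [← t2, ← t2, ← t3]
  rfl

variable (E M) in
/-- The de Rham differential on families of forms. -/
noncomputable def totalD : Module.End ℝ (TotalForm E M) where
  toFun α
    | 0 => 0
    | k + 1 => extD k (α k)
  map_add' α β := by
    funext k
    cases k with
    | zero => exact (add_zero _).symm
    | succ k => exact map_add (extD k) (α k) (β k)
  map_smul' r α := by
    funext k
    cases k with
    | zero => exact (smul_zero (A := Form E M 0) r).symm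
    | succ k => exact map_smul (extD k) r (α k)

theorem totalD_zero (α : TotalForm E M) : totalD E M α 0 = 0 := rfl

theorem totalD_succ (α : TotalForm E M) (k : ℕ) : totalD E M α (k + 1) = extD k (α k) := rfl

theorem totalD_totalD (α : TotalForm E M) : totalD E M (totalD E M α) = 0 := by
  funext k
  match k with
  | 0 => rfl
  | 1 => exact map_zero (extD 0)
  | k + 2 => exact extD_extD (α k)

/-- The interior product on families of forms. -/
noncomputable def totalInterior : VField E M →ₗ[ℝ] Module.End ℝ (TotalForm E M) where
  toFun v :=
    { toFun := fun α k => interior v (α (k + 1))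
      map_add' := fun _ _ => rfl
      map_smul' := fun _ _ => rfl }
  map_add' v w := LinearMap.ext fun α => funext fun k => interior_add v w (α (k + 1))
  map_smul' r v := LinearMap.ext fun α => funext fun k => interior_smul r v (α (k + 1))

theorem totalInterior_apply (v : VField E M) (α : TotalForm E M) (k : ℕ) :
    totalInterior v α k = interior v (α (k + 1)) := rfl

theorem totalInterior_mul_self (v : VField E M) : totalInterior v * totalInterior v = 0 :=
  LinearMap.ext fun α => funext fun k => interior_interior_self v (α (k + 2))

theorem totalInterior_commutator {v w u : VField E M} (h : IsLieBracket v w u)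
    (η : TotalForm E M) :
    totalD E M (totalInterior v (totalInterior w η)) +
      totalInterior v (totalD E M (totalInterior w η)) -
      totalInterior w (totalD E M (totalInterior v η)) -
      totalInterior w (totalInterior v (totalD E M η)) = totalInterior u η := by
  funext k
  cases k with
  | zero =>
    -- The first of the four summands is the degree-zero component of a differential, hence zero.
    have e : ∀ a b c : Form E M 0, 0 + a - b - c = a - b - c := fun a b c => by rw [zero_add]
    exact (e _ _ _).trans (interior_commutator_one h (η 1))
  | succ k => exact interior_commutator h (η (k + 2))

end ManifoldCartan

/-! ### Lie brackets in charts -/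

section ChartLieBracket

variable {F G : Type*} [NormedAddCommGroup F] [NormedSpace ℝ F] [TopologicalSpace G]
  [ChartedSpace F G] [IsManifold 𝓘(ℝ, F) ∞ G]

/-- The manifold Lie bracket pulls fields back with `inverse` of the differential of the inverse
chart, while `chartVec` uses the differential of the chart; the two agree. -/
theorem inverse_mfderiv_symm {ψ : OpenPartialHomeomorph G F} (hψ : ψ ∈ atlas F G) {z : F}
    (hz : z ∈ ψ.target) :
    (mfderiv 𝓘(ℝ, F) 𝓘(ℝ, F) ψ.symm z : F →L[ℝ] F).inverse =
      (mfderiv 𝓘(ℝ, F) 𝓘(ℝ, F) ψ (ψ.symm z) : F →L[ℝ] F) := by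
  have hM : IsManifold 𝓘(ℝ, F) 1 G := inferInstance
  have h1 : MDifferentiableAt 𝓘(ℝ, F) 𝓘(ℝ, F) ψ.symm z := mdifferentiableAt_atlas_symm hψ hz
  have h2 : MDifferentiableAt 𝓘(ℝ, F) 𝓘(ℝ, F) ψ (ψ.symm z) :=
    mdifferentiableAt_atlas hψ (ψ.map_target hz)
  have h3 := h2.hasMFDerivAt.comp z h1.hasMFDerivAt
  have h4 : id =ᶠ[𝓝 z] ψ ∘ ψ.symm := by
    filter_upwards [ψ.open_target.mem_nhds hz] with y hy using (ψ.right_inv hy).symm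
  have h5 := (h3.congr_of_eventuallyEq h4).mfderiv
  rw [mfderiv_id] at h5
  refine ContinuousLinearMap.inverse_eq (ContinuousLinearMap.ext fun w => ?_) h5.symm
  have h6 := mfderiv_symm_mfderiv_apply hψ (ψ.map_target hz) w
  rwa [ψ.right_inv hz] at h6

/-- The chart representative of a vector field that is used in the definition of the Lie bracket. -/
noncomputable def pullbackVec (q : G) (V : (q : G) → TangentSpace 𝓘(ℝ, F) q) (z : F) : F :=
  VectorField.mpullbackWithin 𝓘(ℝ, F) 𝓘(ℝ, F) (extChartAt 𝓘(ℝ, F) q).symm V (range 𝓘(ℝ, F)) z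

theorem pullbackVec_eventuallyEq (q : G) (V : (q : G) → TangentSpace 𝓘(ℝ, F) q) :
    pullbackVec q V =ᶠ[𝓝 (chartAt F q q)] chartVec (chartAt F q) V := by
  filter_upwards [(chartAt F q).open_target.mem_nhds (mem_chart_target F q)] with z hz
  rw [pullbackVec, VectorField.mpullbackWithin_apply, ModelWithCorners.range_eq_univ,
    mfderivWithin_univ]
  exact congrArg (fun A : F →L[ℝ] F => A (V ((chartAt F q).symm z)))
    (inverse_mfderiv_symm (chart_mem_atlas F q) hz)

theorem preimage_univ_inter_range_eq_univ (q : G) :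
    (extChartAt 𝓘(ℝ, F) q).symm ⁻¹' univ ∩ range 𝓘(ℝ, F) = univ := by
  rw [preimage_univ, univ_inter, ModelWithCorners.range_eq_univ]

theorem chartVec_apply {φ : OpenPartialHomeomorph G F} (V : (q : G) → TangentSpace 𝓘(ℝ, F) q)
    {y : F} {q : G} (h : φ.symm y = q) :
    chartVec φ V y = (mfderiv 𝓘(ℝ, F) 𝓘(ℝ, F) φ q : F →L[ℝ] F) (V q : F) := by
  subst h
  rfl

/-- The Lie bracket of vector fields, computed in the preferred chart. -/
theorem mfderiv_mlieBracket (V W : (q : G) → TangentSpace 𝓘(ℝ, F) q) (q : G) :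
    (mfderiv 𝓘(ℝ, F) 𝓘(ℝ, F) (chartAt F q) q : F →L[ℝ] F)
      (VectorField.mlieBracket 𝓘(ℝ, F) V W q : F) =
    VectorField.lieBracket ℝ (chartVec (chartAt F q) V) (chartVec (chartAt F q) W)
      (chartAt F q q) := by
  have hI := isInvertible_mfderiv_extChartAt (I := 𝓘(ℝ, F)) (mem_extChartAt_source (I := 𝓘(ℝ, F)) q)
  -- The manifold bracket is defined as the inverse chart differential of the bracket of the
  -- pulled-back fields, so applying the chart differential undoes the inverse.
  have h : (mfderiv 𝓘(ℝ, F) 𝓘(ℝ, F) (chartAt F q) q : F →L[ℝ] F)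
      (VectorField.mlieBracket 𝓘(ℝ, F) V W q : F) =
      VectorField.lieBracketWithin ℝ (pullbackVec q V) (pullbackVec q W)
        ((extChartAt 𝓘(ℝ, F) q).symm ⁻¹' univ ∩ range 𝓘(ℝ, F)) (chartAt F q q) :=
    hI.self_apply_inverse _
  rw [h, preimage_univ_inter_range_eq_univ, VectorField.lieBracketWithin_univ,
    (pullbackVec_eventuallyEq q V).lieBracket_vectorField_eq (pullbackVec_eventuallyEq q W)]

theorem differentiableAt_chartVec_of_mdifferentiableAt [CompleteSpace F]
    {V : (q : G) → TangentSpace 𝓘(ℝ, F) q} {q : G}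
    (hV : MDifferentiableAt 𝓘(ℝ, F) 𝓘(ℝ, F).tangent
      (fun x => (⟨x, V x⟩ : TangentBundle 𝓘(ℝ, F) G)) q) :
    DifferentiableAt ℝ (chartVec (chartAt F q) V) (chartAt F q q) := by
  have h : DifferentiableWithinAt ℝ (pullbackVec q V)
      ((extChartAt 𝓘(ℝ, F) q).symm ⁻¹' univ ∩ range 𝓘(ℝ, F)) (chartAt F q q) :=
    MDifferentiableWithinAt.differentiableWithinAt_mpullbackWithin_vectorField
      (mdifferentiableWithinAt_univ.2 hV)
  rw [preimage_univ_inter_range_eq_univ, differentiableWithinAt_univ] at h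
  exact h.congr_of_eventuallyEq (pullbackVec_eventuallyEq q V).symm

end ChartLieBracket

/-! ### Fundamental vector fields -/

section Fundamental

variable {E M F G : Type*} [NormedAddCommGroup E] [NormedSpace ℝ E] [TopologicalSpace M]
  [ChartedSpace E M] [IsManifold 𝓘(ℝ, E) ∞ M]
  [NormedAddCommGroup F] [NormedSpace ℝ F] [TopologicalSpace G] [ChartedSpace F G] [Group G]
  [LieGroup 𝓘(ℝ, F) ∞ G] [MulAction G M] [ContMDiffSMul 𝓘(ℝ, F) 𝓘(ℝ, E) ∞ G M]

theorem contMDiff_orbit (p : M) : ContMDiff 𝓘(ℝ, F) 𝓘(ℝ, E) ∞ (fun g : G => g • p) := by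
  have hact : ContMDiff (𝓘(ℝ, F).prod 𝓘(ℝ, E)) 𝓘(ℝ, E) ∞ (fun q : G × M => q.1 • q.2) :=
    ContMDiffSMul.contMDiff_smul
  exact hact.comp (contMDiff_id.prodMk contMDiff_const)

theorem contMDiff_invOrbit (p : M) : ContMDiff 𝓘(ℝ, F) 𝓘(ℝ, E) ∞ (fun g : G => g⁻¹ • p) :=
  (contMDiff_orbit p).comp (contMDiff_inv 𝓘(ℝ, F) ∞)

/-- Differentiate the constant map `g ↦ g • (g⁻¹ • q)` at `1` by the product rule. -/
theorem mfderiv_invOrbit_one (q : M) (x : F) :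
    (mfderiv 𝓘(ℝ, F) 𝓘(ℝ, E) (fun g : G => g⁻¹ • q) 1 : F →L[ℝ] E) x =
      -(mfderiv 𝓘(ℝ, F) 𝓘(ℝ, E) (fun g : G => g • q) 1 : F →L[ℝ] E) x := by
  have hact : ContMDiff (𝓘(ℝ, F).prod 𝓘(ℝ, E)) 𝓘(ℝ, E) ∞ (fun r : G × M => r.1 • r.2) :=
    ContMDiffSMul.contMDiff_smul
  have h0 : MDifferentiableAt 𝓘(ℝ, F) 𝓘(ℝ, E) (fun g : G => g⁻¹ • q) 1 :=
    (contMDiff_invOrbit q).mdifferentiableAt (by simp)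
  have h1 := (hasMFDerivAt_id (I := 𝓘(ℝ, F)) (1 : G)).prodMk
    h0.hasMFDerivAt
  have h2 := (hact.mdifferentiableAt (x := ((1 : G), (1 : G)⁻¹ • q)) (by simp)).hasMFDerivAt.comp
    (1 : G) h1
  have h3 : HasMFDerivAt 𝓘(ℝ, F) 𝓘(ℝ, E) (fun _ : G => q) 1 _ :=
    h2.congr_of_eventuallyEq (Filter.Eventually.of_forall fun g => (smul_inv_smul g q).symm)
  have h4 := DFunLike.congr_fun (h3.mfderiv.symm.trans mfderiv_const) x
  have h5 := mfderiv_prod_eq_add_apply (I := 𝓘(ℝ, F)) (I' := 𝓘(ℝ, E)) (I'' := 𝓘(ℝ, E))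
    (f := fun r : G × M => r.1 • r.2) (p := ((1 : G), (1 : G)⁻¹ • q))
    (v := (x, (mfderiv 𝓘(ℝ, F) 𝓘(ℝ, E) (fun g : G => g⁻¹ • q) 1 : F →L[ℝ] E) x))
    (hact.mdifferentiableAt (by simp))
  have h6 : (mfderiv 𝓘(ℝ, F) 𝓘(ℝ, E) (fun g : G => g • ((1 : G)⁻¹ • q)) 1 : F →L[ℝ] E) x +
      (mfderiv 𝓘(ℝ, E) 𝓘(ℝ, E) (fun r : M => (1 : G) • r) ((1 : G)⁻¹ • q) : E →L[ℝ] E)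
        ((mfderiv 𝓘(ℝ, F) 𝓘(ℝ, E) (fun g : G => g⁻¹ • q) 1 : F →L[ℝ] E) x) = 0 := h5.symm.trans h4
  have e1 : (fun g : G => g • ((1 : G)⁻¹ • q)) = fun g => g • q := by simp
  have e2 : (fun r : M => (1 : G) • r) = id := funext (one_smul G)
  have e3 : ∀ (r : M) (u : E), (mfderiv 𝓘(ℝ, E) 𝓘(ℝ, E) (id : M → M) r : E →L[ℝ] E) u = u := by
    intro r u
    rw [mfderiv_id]
    rfl
  rw [e1, e2] at h6
  exact eq_neg_of_add_eq_zero_right ((congrArg (fun a : E =>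
    HAdd.hAdd (α := E) ((mfderiv 𝓘(ℝ, F) 𝓘(ℝ, E) (fun g : G => g • q) 1 : F →L[ℝ] E) x) a)
    (e3 _ _)).symm.trans h6)

/-- The map `g ↦ g⁻¹ • p` relates the left invariant vector fields and the fundamental ones. -/
theorem mfderiv_invOrbit_mulInvariantVectorField (p : M) (x : GroupLieAlgebra 𝓘(ℝ, F) G) (g : G) :
    (mfderiv 𝓘(ℝ, F) 𝓘(ℝ, E) (fun g : G => g⁻¹ • p) g : F →L[ℝ] E)
      (mulInvariantVectorField x g : F) = (fundAt E F G (g⁻¹ • p) x : E) := by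
  have h0 : MDifferentiableAt 𝓘(ℝ, F) 𝓘(ℝ, E) (fun g : G => g⁻¹ • p) (g * 1) :=
    (contMDiff_invOrbit p).mdifferentiableAt (by simp)
  have h1 : MDifferentiableAt 𝓘(ℝ, F) 𝓘(ℝ, F) (fun h : G => g * h) 1 :=
    (contMDiff_mul_left (I := 𝓘(ℝ, F)) (n := ∞)).mdifferentiableAt (by simp)
  have h2 := mfderiv_comp (1 : G) h0 h1
  -- Left translation by `g` only replaces the base point `p` by `g⁻¹ • p`, so the chain rule
  -- reduces the claim to the derivative at `1`.
  have h3 : ((fun g : G => g⁻¹ • p) ∘ fun h : G => g * h) = fun h : G => h⁻¹ • (g⁻¹ • p) := by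
    funext h
    simp [mul_smul]
  have h4 : ∀ r r' : G, r = r' → (mfderiv 𝓘(ℝ, F) 𝓘(ℝ, E) (fun g : G => g⁻¹ • p) r : F →L[ℝ] E) =
      (mfderiv 𝓘(ℝ, F) 𝓘(ℝ, E) (fun g : G => g⁻¹ • p) r' : F →L[ℝ] E) := by
    rintro r _ rfl; rfl
  rw [h3] at h2
  have h5 := DFunLike.congr_fun h2 x
  have h6 := mfderiv_invOrbit_one (F := F) (G := G) (E := E) (g⁻¹ • p) x
  refine Eq.trans ?_ (h5.symm.trans h6)
  exact congrArg (fun A : F →L[ℝ] E => A (mulInvariantVectorField x g : F))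
    (h4 _ _ (mul_one g).symm)

/-- The map `g ↦ g⁻¹ • p` carries left invariant fields to fundamental fields, and related fields
have related brackets. The inversion matches the minus sign in `v_x`, so that brackets are preserved
without a sign. -/
theorem isLieBracket_fundVField [CompleteSpace F] (x y : GroupLieAlgebra 𝓘(ℝ, F) G) :
    IsLieBracket (fundVField x : VField E M) (fundVField y) (fundVField ⁅x, y⁆) := by
  intro p
  set φ := chartAt E p with hφdef
  set ψ := chartAt F (1 : G) with hψdef
  have hφ : φ ∈ atlas E M := chart_mem_atlas E p
  have hψ : ψ ∈ atlas F G := chart_mem_atlas F 1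
  have h1s : (1 : G) ∈ ψ.source := mem_chart_source F 1
  have h1t : ψ 1 ∈ ψ.target := ψ.map_source h1s
  have hM : IsManifold 𝓘(ℝ, E) 1 M := inferInstance
  have hG : IsManifold 𝓘(ℝ, F) 1 G := inferInstance
  let o : G → M := fun g => g⁻¹ • p
  have ho : ContMDiff 𝓘(ℝ, F) 𝓘(ℝ, E) ∞ o := contMDiff_invOrbit p
  have ho1 : o 1 = p := by simp [o]
  let f : F → E := fun z => φ (o (ψ.symm z))
  have hf1 : f (ψ 1) = φ p := by simp only [f]; rw [ψ.left_inv h1s, ho1]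
  have hfd : ∀ z ∈ ψ.target, o (ψ.symm z) ∈ φ.source → ∀ w : F,
      fderiv ℝ f z w = (mfderiv 𝓘(ℝ, E) 𝓘(ℝ, E) φ (o (ψ.symm z)) : E →L[ℝ] E)
        ((mfderiv 𝓘(ℝ, F) 𝓘(ℝ, E) o (ψ.symm z) : F →L[ℝ] E)
          ((mfderiv 𝓘(ℝ, F) 𝓘(ℝ, F) ψ.symm z : F →L[ℝ] F) w)) := by
    intro z hz hz' w
    have d1 : MDifferentiableAt 𝓘(ℝ, F) 𝓘(ℝ, F) ψ.symm z := mdifferentiableAt_atlas_symm hψ hz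
    have d2 : MDifferentiableAt 𝓘(ℝ, F) 𝓘(ℝ, E) o (ψ.symm z) := ho.mdifferentiableAt (by simp)
    have d3 : MDifferentiableAt 𝓘(ℝ, E) 𝓘(ℝ, E) φ (o (ψ.symm z)) := mdifferentiableAt_atlas hφ hz'
    have d4 := (d3.hasMFDerivAt.comp _ d2.hasMFDerivAt).comp z d1.hasMFDerivAt
    have d5 := d4.mfderiv
    rw [mfderiv_eq_fderiv] at d5
    exact DFunLike.congr_fun d5 w
  have hrel : ∀ u : GroupLieAlgebra 𝓘(ℝ, F) G, ∀ z ∈ ψ.target, o (ψ.symm z) ∈ φ.source →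
      chartVec φ (fundVField u : VField E M) (f z) =
        fderiv ℝ f z (chartVec ψ (mulInvariantVectorField u) z) := by
    intro u z hz hz'
    rw [hfd z hz hz', chartVec_apply _ (φ.left_inv hz')]
    refine congrArg (mfderiv 𝓘(ℝ, E) 𝓘(ℝ, E) φ (o (ψ.symm z)) : E →L[ℝ] E) ?_
    refine (mfderiv_invOrbit_mulInvariantVectorField p u (ψ.symm z)).symm.trans ?_
    refine congrArg (mfderiv 𝓘(ℝ, F) 𝓘(ℝ, E) o (ψ.symm z) : F →L[ℝ] E) ?_
    have h := mfderiv_symm_mfderiv_apply hψ (ψ.map_target hz) (mulInvariantVectorField u (ψ.symm z))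
    rw [ψ.right_inv hz] at h
    exact h.symm
  have hev : ∀ᶠ z in 𝓝 (ψ 1), z ∈ ψ.target ∧ o (ψ.symm z) ∈ φ.source := by
    have hc : ContinuousAt (fun z => o (ψ.symm z)) (ψ 1) :=
      ho.continuous.continuousAt.comp (ψ.continuousAt_symm h1t)
    refine Filter.Eventually.and (ψ.open_target.mem_nhds h1t) (hc.preimage_mem_nhds (φ.open_source.mem_nhds ?_))
    rw [ψ.left_inv h1s, ho1]
    exact mem_chart_source E p
  have hfs : ContDiffAt ℝ 2 f (ψ 1) := by
    have h : ContMDiffAt 𝓘(ℝ, F) 𝓘(ℝ, E) ∞ f (ψ 1) := by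
      refine (contMDiffAt_of_mem_maximalAtlas (IsManifold.subset_maximalAtlas hφ) hev.self_of_nhds.2).comp
        (ψ 1) (ho.contMDiffAt.comp (ψ 1)
          (contMDiffAt_symm_of_mem_maximalAtlas (IsManifold.subset_maximalAtlas hψ) h1t))
    exact (contMDiffAt_iff_contDiffAt.1 h).of_le (ENat.LEInfty.out : (2 : WithTop ℕ∞) ≤ ∞)
  have hX : ∀ u : GroupLieAlgebra 𝓘(ℝ, F) G,
      DifferentiableAt ℝ (chartVec ψ (mulInvariantVectorField u)) (ψ 1) := fun u =>
    differentiableAt_chartVec_of_mdifferentiableAt (mdifferentiableAt_mulInvariantVectorField u)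
  have hV : ∀ u : GroupLieAlgebra 𝓘(ℝ, F) G,
      DifferentiableAt ℝ (chartVec φ (fundVField u : VField E M)) (f (ψ 1)) := fun u => by
    rw [hf1]
    exact differentiableAt_chartVec _ p
  have key := lieBracket_of_related hfs (hX x) (hX y) (hV x) (hV y)
    (hev.mono fun z hz => hrel x z hz.1 hz.2) (hev.mono fun z hz => hrel y z hz.1 hz.2)
  rw [hf1] at key
  rw [key, ← mfderiv_mlieBracket, ← hf1, hrel _ _ h1t hev.self_of_nhds.2,
    chartVec_apply _ (ψ.left_inv h1s), GroupLieAlgebra.bracket_def, mulInvariantVector_mlieBracket]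


end Fundamental

/-! ### Order reversal in iterated contractions -/

section Reversal

variable {V T : Type*} [AddCommGroup V] [Module ℝ V] [AddCommGroup T] [Module ℝ T]
  (I : V →ₗ[ℝ] Module.End ℝ T) (hI : ∀ a, I a * I a = 0)

theorem iterContraction_comp {V' : Type*} [AddCommGroup V'] [Module ℝ V'] (g : V' →ₗ[ℝ] V)
    (hJ : ∀ a, (I ∘ₗ g) a * (I ∘ₗ g) a = 0) (k : ℕ) (α : T) (x : Fin k → V') :
    iterContraction (I ∘ₗ g) hJ k α x = iterContraction I hI k α (fun i => g (x i)) := by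
  induction k with
  | zero => simp [iterContraction_zero]
  | succ k ih => rw [iterContraction_succ, iterContraction_succ, ih]; rfl

theorem iterContraction_snoc {k : ℕ} (α : T) (y : Fin k → V) (a : V) :
    iterContraction I hI (k + 1) α (Fin.snoc y a) = iterContraction I hI k (I a α) y := by
  induction k with
  | zero =>
    rw [iterContraction_succ, iterContraction_zero, iterContraction_zero]
    rfl
  | succ k ih =>
    have h0 : (Fin.snoc y a : Fin (k + 2) → V) 0 = y 0 := Fin.snoc_castSucc (i := 0) ..
    have h1 : Fin.tail (Fin.snoc y a : Fin (k + 2) → V) = Fin.snoc (Fin.tail y) a := by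
      funext i
      refine Fin.lastCases ?_ (fun i => ?_) i
      · rw [Fin.snoc_last, Fin.tail, Fin.succ_last, Fin.snoc_last]
      · rw [Fin.snoc_castSucc, Fin.tail, Fin.succ_castSucc, Fin.snoc_castSucc, Fin.tail]
    rw [iterContraction_succ, iterContraction_succ _ _ _ y, h0, h1, ih]

theorem succ_mul_div_two (k : ℕ) : (k + 1) * k / 2 = k + k * (k - 1) / 2 := by
  cases k with
  | zero => rfl
  | succ n =>
    rw [show (n + 1 + 1) * (n + 1) = (n + 1) * (n + 1 - 1) + 2 * (n + 1) by simp; ring,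
      Nat.add_mul_div_left _ _ two_pos, add_comm]

theorem iterContraction_rev (k : ℕ) (α : T) (y : Fin k → V) :
    iterContraction I hI k α (fun i => y i.rev) =
      (-1 : ℝ) ^ (k * (k - 1) / 2) • iterContraction I hI k α y := by
  induction k with
  | zero => simp [iterContraction_zero]
  | succ k ih =>
    -- Moving the last argument to the front costs `(-1)^k`; reversing the other `k` arguments is
    -- the induction hypothesis.
    have h1 := (iterContraction I hI (k + 1) α).map_insertNth (Fin.last k) (y (Fin.last k))
      (Fin.init y)
    rw [Fin.insertNth_last', Fin.snoc_init_self, iterContraction_vecCons] at h1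
    have h2 : Fin.tail (fun i : Fin (k + 1) => y i.rev) = fun i => Fin.init y i.rev := by
      funext i
      simp [Fin.tail, Fin.init, Fin.rev_succ]
    rw [iterContraction_succ, h2, ih, h1, map_smul, Nat.add_sub_cancel, succ_mul_div_two, Fin.rev_zero,
      pow_add, ← Int.cast_smul_eq_zsmul ℝ, smul_smul]
    congr 1
    have h3 : (-1 : ℝ) ^ k * (-1) ^ k = 1 := by rw [← mul_pow]; simp
    rw [Fin.val_last]
    push_cast
    linear_combination (-(-1 : ℝ) ^ (k * (k - 1) / 2)) * h3

end Reversal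

/-! ### Forms of degree zero -/

section DegreeZero

variable {E M : Type*} [NormedAddCommGroup E] [NormedSpace ℝ E] [TopologicalSpace M]
  [ChartedSpace E M]

variable (E M) in
/-- The constant functions, as forms of degree zero. -/
noncomputable def constForm : ℝ →ₗ[ℝ] Form E M 0 where
  toFun r := ⟨fun q => ContinuousAlternatingMap.constOfIsEmpty ℝ (TangentSpace 𝓘(ℝ, E) q) (Fin 0) r,
    fun _ _ => contDiffOn_const (c := ContinuousAlternatingMap.constOfIsEmpty ℝ E (Fin 0) r)⟩
  map_add' _ _ := rfl
  map_smul' _ _ := rfl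

theorem constForm_apply (r : ℝ) (q : M) (w) : (constForm E M r).1 q w = r := rfl

/-- The value at a point of a form of degree zero. -/
noncomputable def evalZero (p : M) : Form E M 0 →ₗ[ℝ] ℝ where
  toFun η := η.1 p (fun i => i.elim0)
  map_add' _ _ := rfl
  map_smul' _ _ := rfl

theorem evalZero_apply (p : M) (η : Form E M 0) (w : Fin 0 → TangentSpace 𝓘(ℝ, E) p) :
    evalZero p η = η.1 p w := congrArg (η.1 p) (Subsingleton.elim _ _)

variable [IsManifold 𝓘(ℝ, E) ∞ M]

theorem extD_constForm (r : ℝ) : extD 0 (constForm E M r) = 0 := by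
  refine form_ext_chartRep fun p => ?_
  have h : chartRep (chartAt E p) (constForm E M r).1 =
    fun _ => ContinuousAlternatingMap.constOfIsEmpty ℝ E (Fin 0) r := rfl
  rw [chartRep_extD (chart_mem_atlas E p) _ (mem_chart_target E p), h]
  refine ContinuousAlternatingMap.ext fun w => ?_
  rw [extDeriv_apply_eq_sum]
  simp
  rfl

/-- On a connected manifold, closed forms of degree zero are constant. -/
theorem eq_constForm_of_extD_eq_zero [PreconnectedSpace M] {η : Form E M 0} (h : extD 0 η = 0)
    (p : M) : η = constForm E M (evalZero p η) := by
  have hloc : IsLocallyConstant fun q => evalZero q η := by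
    rw [IsLocallyConstant.iff_eventually_eq]
    intro q
    have hφ := chart_mem_atlas E q
    have hq := mem_chart_target E q
    obtain ⟨ε, hε, hB⟩ := Metric.mem_nhds_iff.1 ((chartAt E q).open_target.mem_nhds hq)
    have hval : ∀ r ∈ (chartAt E q).source, evalZero r η =
        chartRep (chartAt E q) η.1 (chartAt E q r) (fun i => i.elim0) := by
      intro r hr
      refine (apply_eq_chartRep hφ η.1 hr _).trans ?_
      congr 1
      exact Subsingleton.elim _ _
    have hconst : ∀ y ∈ Metric.ball (chartAt E q q) ε, chartRep (chartAt E q) η.1 y =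
        chartRep (chartAt E q) η.1 (chartAt E q q) := fun y hy =>
      Metric.isOpen_ball.is_const_of_fderiv_eq_zero (𝕜 := ℝ)
      (convex_ball (chartAt E q q) ε).isPreconnected
      (((η.2 _ hφ).differentiableOn (by simp)).mono hB) (fun y hy => by
        ext v u
        -- In degree zero the exterior derivative is the ordinary derivative, which therefore
        -- vanishes on a ball in the chart.
        rw [← extDeriv_curryLeft_zero, ← chartRep_extD hφ η (hB hy), h]
        rfl) hy (Metric.mem_ball_self hε)
    filter_upwards [((chartAt E q).continuousAt (mem_chart_source E q)).preimage_mem_nhds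
      (Metric.ball_mem_nhds _ hε), (chartAt E q).open_source.mem_nhds (mem_chart_source E q)]
      with r hr hr'
    rw [hval r hr', hval q (mem_chart_source E q),
      hconst _ hr]
  refine Subtype.ext (funext fun q => ContinuousAlternatingMap.ext fun w => ?_)
  rw [constForm_apply, ← evalZero_apply]
  exact hloc.apply_eq_of_isPreconnected isPreconnected_univ (mem_univ q) (mem_univ p)

end DegreeZero

/-! ### Primitives -/

section Primitives

/-- Over a field, every linear map has a linear right inverse on its range. -/
theorem exists_rightInverse_on_range {V W : Type*} [AddCommGroup V] [Module ℝ V] [AddCommGroup W]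
    [Module ℝ W] (f : V →ₗ[ℝ] W) : ∃ g : W →ₗ[ℝ] V, ∀ w ∈ LinearMap.range f, f (g w) = w := by
  obtain ⟨g, hg⟩ := f.rangeRestrict.exists_rightInverse_of_surjective f.range_rangeRestrict
  obtain ⟨g', hg'⟩ := g.exists_extend
  refine ⟨g', fun w hw => ?_⟩
  have h1 := DFunLike.congr_fun hg' ⟨w, hw⟩
  have h2 := congrArg Subtype.val (DFunLike.congr_fun hg ⟨w, hw⟩)
  have h3 : g' w = g ⟨w, hw⟩ := h1
  rw [h3]
  exact h2

variable {E M : Type*} [NormedAddCommGroup E] [NormedSpace ℝ E] [TopologicalSpace M]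
  [ChartedSpace E M] [IsManifold 𝓘(ℝ, E) ∞ M]

theorem mem_range_extD {k : ℕ} (h : Subsingleton (DeRhamCohomology E M (k + 1)))
    {β : Form E M (k + 1)} (hβ : extD (k + 1) β = 0) : β ∈ LinearMap.range (extD (E := E) (M := M) k) := by
  have h1 := (Submodule.Quotient.mk_eq_zero ((exactForms E M (k + 1)).submoduleOf
    (LinearMap.ker (extD (E := E) (M := M) (k + 1)))) (x := ⟨β, hβ⟩)).1 (Subsingleton.elim _ _)
  exact h1

/-- A linear primitive operator for families of closed forms in degrees `1, …, m`. -/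
theorem exists_primitive (m : ℕ)
    (hdR : ∀ i : ℕ, 1 ≤ i → i ≤ m → Subsingleton (DeRhamCohomology E M i)) :
    ∃ P : Module.End ℝ (TotalForm E M), (∀ β j, β (j + 1) = 0 → P β j = 0) ∧
      ∀ β, totalD E M β = 0 → (∀ j, j = 0 ∨ m < j → β j = 0) → totalD E M (P β) = β := by
  -- The primitives are chosen linearly, so that composing an alternating map with `P` gives an
  -- alternating map again.
  choose g hg using fun k => exists_rightInverse_on_range (extD (E := E) (M := M) k)
  refine ⟨LinearMap.pi fun j => g j ∘ₗ LinearMap.proj (j + 1), fun β j h => ?_, fun β h1 h2 => ?_⟩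
  · change g j (β (j + 1)) = 0
    rw [h, map_zero]
  · funext j
    cases j with
    | zero => exact (h2 0 (Or.inl rfl)).symm
    | succ j =>
      by_cases hj : m < j + 1
      · change extD j (g j (β (j + 1))) = _
        rw [h2 _ (Or.inr hj), map_zero, map_zero]
      · exact hg j _ (mem_range_extD (hdR _ (by omega) (by omega)) (congrFun h1 (j + 1 + 1)))

end Primitives

/-! ### The components of the homotopy moment map -/

section Components

variable {E M : Type*} [NormedAddCommGroup E] [NormedSpace ℝ E] [TopologicalSpace M]
  [ChartedSpace E M] [IsManifold 𝓘(ℝ, E) ∞ M] {𝔤 : Type*} [LieRing 𝔤] [LieAlgebra ℝ 𝔤]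

/-- A form, regarded as a family concentrated in one degree. -/
noncomputable def singleForm (k : ℕ) : Form E M k →ₗ[ℝ] TotalForm E M :=
  LinearMap.single ℝ (fun k => Form E M k) k

theorem singleForm_same (k : ℕ) (η : Form E M k) : singleForm k η k = η := Pi.single_eq_same ..

theorem singleForm_of_ne {k j : ℕ} (h : j ≠ k) (η : Form E M k) : singleForm k η j = 0 :=
  Pi.single_eq_of_ne (M := fun k => Form E M k) h η

theorem totalD_singleForm (k : ℕ) (η : Form E M k) :
    totalD E M (singleForm k η) = singleForm (k + 1) (extD k η) := by
  funext j
  cases j with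
  | zero => exact (singleForm_of_ne (by omega) _).symm
  | succ j =>
    rw [totalD_succ]
    by_cases h : j = k
    · subst h; rw [singleForm_same, singleForm_same]
    · rw [singleForm_of_ne h, singleForm_of_ne (by omega), map_zero]

theorem totalInterior_singleForm (k : ℕ) (v : VField E M) (η : Form E M (k + 1)) :
    totalInterior v (singleForm (k + 1) η) = singleForm k (interior v η) := by
  funext j
  rw [totalInterior_apply]
  by_cases h : j = k
  · subst h; rw [singleForm_same, singleForm_same]
  · rw [singleForm_of_ne (by omega), singleForm_of_ne h, map_zero]

theorem apply_bracketOp_eq_zero {k j : ℕ} {c : 𝔤 [⋀^Fin k]→ₗ[ℝ] TotalForm E M}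
    (h : ∀ x, c x j = 0) (x) : bracketOp c x j = 0 := by
  have h1 := bracketOp_compAlternatingMap (LinearMap.proj (R := ℝ) (φ := fun k => Form E M k) j) c
  have h2 : (LinearMap.proj (R := ℝ) (φ := fun k => Form E M k) j).compAlternatingMap c =
      (0 : ℝ) • (0 : 𝔤 [⋀^Fin k]→ₗ[ℝ] Form E M j) := by
    ext1 x; simp [h]
  rw [h2, bracketOp_smul, zero_smul] at h1
  exact (DFunLike.congr_fun h1 x).symm

theorem iterContraction_apply_eq_zero {V : Type*} [AddCommGroup V] [Module ℝ V]
    (X : V →ₗ[ℝ] VField E M) (hX : ∀ a, (totalInterior ∘ₗ X) a * (totalInterior ∘ₗ X) a = 0)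
    {l : ℕ} {α : TotalForm E M} (hα : ∀ j, j ≠ l → α j = 0) (k : ℕ) {j : ℕ} (h : j + k ≠ l)
    (x : Fin k → V) : iterContraction (totalInterior ∘ₗ X) hX k α x j = 0 := by
  induction k generalizing j with
  | zero => rw [iterContraction_zero]; exact hα j h
  | succ k ih =>
    rw [iterContraction_succ]
    change interior (X (x 0)) (iterContraction (totalInterior ∘ₗ X) hX k α (Fin.tail x) (j + 1)) = 0
    rw [ih (by omega), map_zero]

/-- The value at a point of the iterated contractions in degree zero. -/
theorem evalZero_iterContraction (p : M) (k : ℕ) (α : TotalForm E M) (y : Fin k → VField E M) :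
    evalZero p (iterContraction totalInterior totalInterior_mul_self k α y 0) =
      (α k).1 p (fun i => y i.rev p) := by
  induction k generalizing α with
  | zero =>
    rw [iterContraction_zero]
    exact evalZero_apply p _ _
  | succ k ih =>
    have h := ih (totalInterior (y (Fin.last k)) α) (Fin.init y)
    rw [← iterContraction_snoc, Fin.snoc_init_self] at h
    rw [h]
    refine congrArg ((α (k + 1)).1 p) (funext fun i => ?_)
    refine Fin.cases ?_ (fun i => ?_) i
    · rw [Fin.rev_zero]; rfl
    · rw [Fin.rev_succ]; rfl

/-- Iterated interior products in terms of `iterContraction`. -/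
theorem contract_apply (p k : ℕ) (v : Fin p → VField E M) (α : TotalForm E M) :
    contract p v (α (k + p)) =
      iterContraction totalInterior totalInterior_mul_self p α (fun i => v i.rev) k := by
  induction p generalizing α with
  | zero => rw [iterContraction_zero]; rfl
  | succ p ih =>
    have h := ih (fun i => v i.succ) (totalInterior (v 0) α)
    have hv : (fun i : Fin (p + 1) => v i.rev) = Fin.snoc (fun i : Fin p => v i.rev.succ) (v 0) := by
      funext i
      refine Fin.lastCases ?_ (fun i => ?_) i
      · simp
      · simp [Fin.rev_castSucc]
    rw [hv, iterContraction_snoc, ← h]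
    rfl

theorem varsig_mul_self (k : ℕ) : varsig k * varsig k = 1 := by
  rw [varsig, neg_mul_neg, ← mul_pow]; simp

/-- `ς(k) ι(v_1 ∧ ⋯ ∧ v_k)` in terms of `iterContraction`. -/
theorem varsig_smul_contract (p k : ℕ) (v : Fin p → VField E M) (α : TotalForm E M) :
    varsig p • contract p v (α (k + p)) =
      (-1 : ℝ) ^ (p + 1) • iterContraction totalInterior totalInterior_mul_self p α v k := by
  rw [contract_apply, iterContraction_rev, Pi.smul_apply, smul_smul]
  congr 1
  -- The sign in `ς(p)` and the reversal sign have exponents differing by `p`, so their product is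
  -- `-(-1)^p`.
  have h : p * (p + 1) / 2 = p + p * (p - 1) / 2 := by rw [mul_comm, succ_mul_div_two]
  have h2 : (-1 : ℝ) ^ (p * (p - 1) / 2) * (-1) ^ (p * (p - 1) / 2) = 1 := by
    rw [← mul_pow]; simp
  rw [varsig, h, pow_add, pow_succ]
  linear_combination (-(-1 : ℝ) ^ p) * h2

/-- The components of the homotopy moment map, as solutions of
`bracketOp f_k = D f_{k+1} + (-1)^k A_{k+1}`. -/
theorem exists_components [PreconnectedSpace M] (X : 𝔤 →ₗ[ℝ] VField E M)
    (hX : ∀ a b, IsLieBracket (X a) (X b) (X ⁅a, b⁆)) (m : ℕ) (ϖ : Form E M (m + 2))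
    (hϖ : extD (m + 2) ϖ = 0) (φ : 𝔤 →ₗ[ℝ] Form E M m)
    (hφ : ∀ x, extD m (φ x) = -interior (X x) ϖ)
    (hdR : ∀ i : ℕ, 1 ≤ i → i ≤ m → Subsingleton (DeRhamCohomology E M i)) (p : M)
    (z : 𝔤 [⋀^Fin (m + 1)]→ₗ[ℝ] ℝ)
    (hz : ∀ x, bracketSum z x = ϖ.1 p (fun i => X (x i) p)) :
    ∃ f : (k : ℕ) → 𝔤 [⋀^Fin k]→ₗ[ℝ] TotalForm E M,
      (∀ k x j, j + k ≠ m + 1 → f k x j = 0) ∧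
      (∀ k x, bracketSum (f (k + 1)) x = totalD E M (f (k + 2) x) +
        (-1 : ℝ) ^ (k + 1) • iterContraction totalInterior totalInterior_mul_self (k + 2)
          (singleForm (m + 2) ϖ) (fun i => X (x i))) ∧
      (1 ≤ m → ∀ x, f 1 ![x] = singleForm m (φ x)) ∧
      (m = 0 → ∃ b : 𝔤 →ₗ[ℝ] ℝ, ∀ x,
        f 1 ![x] = singleForm m (φ x) + singleForm 0 (constForm E M (b x))) := by
  have hJ : ∀ a, (totalInterior ∘ₗ X) a * (totalInterior ∘ₗ X) a = 0 := fun a =>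
    totalInterior_mul_self (X a)
  set J := totalInterior ∘ₗ X
  have hbr : ∀ a b η, totalD E M (J a (J b η)) + J a (totalD E M (J b η)) -
      J b (totalD E M (J a η)) - J b (J a (totalD E M η)) = J ⁅a, b⁆ η :=
    fun a b η => totalInterior_commutator (hX a b) η
  set Ω := singleForm (m + 2) ϖ with hΩ
  have hΩ' : ∀ j, j ≠ m + 2 → Ω j = 0 := fun j hj => singleForm_of_ne hj ϖ
  have h0 : totalD E M Ω = 0 := by rw [hΩ, totalD_singleForm, hϖ, map_zero]
  let φ' : 𝔤 [⋀^Fin 1]→ₗ[ℝ] TotalForm E M :=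
    AlternatingMap.ofSubsingleton ℝ 𝔤 (TotalForm E M) 0 (singleForm m ∘ₗ φ)
  have hφ' : ∀ x, φ' x = singleForm m (φ (x 0)) := fun x => rfl
  have hJΩ : ∀ a, J a Ω = -totalD E M (singleForm m (φ a)) := fun a => by
    rw [totalD_singleForm, hφ, map_neg, neg_neg]
    exact totalInterior_singleForm (m + 1) (X a) ϖ
  have h1 : ∀ a, totalD E M (J a Ω) = 0 := fun a => by
    rw [hJΩ, map_neg, totalD_totalD, neg_zero]
  obtain ⟨P, hP0, hP⟩ := exists_primitive (E := E) (M := M) m hdR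
  let A := fun k => iterContraction J hJ k Ω
  have hA : ∀ k x j, j + k ≠ m + 2 → A k x j = 0 := fun k x j h =>
    iterContraction_apply_eq_zero X hJ hΩ' k h x
  let g := momentSeq J hJ P φ' Ω
  let β : (k : ℕ) → 𝔤 [⋀^Fin (k + 2)]→ₗ[ℝ] TotalForm E M := fun k =>
    bracketOp (g (k + 1)) + (-1 : ℝ) ^ k • A (k + 2)
  have hβconc : ∀ k, (∀ x j, j + (k + 1) ≠ m + 1 → g (k + 1) x j = 0) →
      ∀ x j, j + (k + 2) ≠ m + 2 → β k x j = 0 := by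
    intro k hk x j hj
    change bracketOp (g (k + 1)) x j + (-1 : ℝ) ^ k • A (k + 2) x j = 0
    rw [hA _ _ _ hj, smul_zero, add_zero]
    exact apply_bracketOp_eq_zero (fun x => hk x j (by omega)) x
  have hgconc : ∀ k x j, j + k ≠ m + 1 → g k x j = 0 := by
    intro k
    match k with
    | 0 => intro x j _; rfl
    | k + 1 =>
      induction k with
      | zero =>
        intro x j hj
        exact singleForm_of_ne (by omega) _
      | succ k ih =>
        intro x j hj
        exact hP0 _ _ (hβconc k ih x (j + 1) (by omega))
  -- The bound on `k` is where primitives run out: producing `g (k + 2)` inverts `d` on forms of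
  -- degree `m - k`, which must be at least `1`.
  have hgD : ∀ k, k ≤ m → (totalD E M).compAlternatingMap (g (k + 1)) =
      bracketOp (g k) - (-1 : ℝ) ^ k • A (k + 1) := by
    intro k
    induction k with
    | zero =>
      intro _
      ext1 x
      have e : A 1 x = J (x 0) Ω := by
        change iterContraction J hJ 1 Ω x = _
        rw [iterContraction_succ, iterContraction_zero]
      change totalD E M (singleForm m (φ (x 0))) = (0 : TotalForm E M) - (-1 : ℝ) ^ 0 • A 1 x
      rw [e, hJΩ, pow_zero, one_smul, zero_sub, neg_neg]
    | succ k ih =>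
      intro hk
      have h2 := comp_bracketOp_add_iterContraction_eq_zero hJ hbr h0 h1 (ih (by omega))
      ext1 x
      have h3 : totalD E M (P (β k x)) = β k x :=
        hP _ (DFunLike.congr_fun h2 x) fun j hj => hβconc k (hgconc (k + 1)) x j (by omega)
      refine h3.trans ?_
      change bracketOp (g (k + 1)) x + (-1 : ℝ) ^ k • A (k + 2) x =
        bracketOp (g (k + 1)) x - (-1 : ℝ) ^ (k + 1) • A (k + 2) x
      rw [pow_succ, mul_neg_one, neg_smul, sub_neg_eq_add]
  have htop := comp_bracketOp_add_iterContraction_eq_zero hJ hbr h0 h1 (hgD m le_rfl)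
  let ev : TotalForm E M →ₗ[ℝ] ℝ := evalZero p ∘ₗ LinearMap.proj (R := ℝ) (φ := fun k => Form E M k) 0
  let cst : ℝ →ₗ[ℝ] TotalForm E M := singleForm 0 ∘ₗ constForm E M
  have hDcst : ∀ r, totalD E M (cst r) = 0 := fun r => by
    change totalD E M (singleForm 0 (constForm E M r)) = 0
    rw [totalD_singleForm, extD_constForm, map_zero]
  -- The last obstruction lives in degree zero only and is closed, so it equals its value at `p`.
  have hβtop : ∀ x, β m x = cst (ev (β m x)) := by
    intro x
    funext j
    cases j with
    | zero =>
      refine (eq_constForm_of_extD_eq_zero (congrFun (DFunLike.congr_fun htop x) 1) p).trans ?_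
      exact (singleForm_same 0 _).symm
    | succ j =>
      rw [hβconc m (hgconc (m + 1)) x _ (by omega)]
      exact (singleForm_of_ne (Nat.succ_ne_zero j) (constForm E M (ev (β m x)))).symm
  -- The first term cancels the value of `g (m + 1)` at `p`; the multiple of `z` cancels the value
  -- of `A (m + 2)`, its sign combining that of the recursion with the one from reversing the
  -- arguments of `ω`.
  let b : 𝔤 [⋀^Fin (m + 1)]→ₗ[ℝ] ℝ :=
    -ev.compAlternatingMap (g (m + 1)) - ((-1 : ℝ) ^ m * (-1) ^ ((m + 2) * (m + 2 - 1) / 2)) • z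
  have hevA : ∀ x, ev (A (m + 2) x) =
      (-1 : ℝ) ^ ((m + 2) * (m + 2 - 1) / 2) * ϖ.1 p (fun i => X (x i) p) := by
    intro x
    change evalZero p (iterContraction J hJ (m + 2) Ω x 0) = _
    refine (congrArg (fun α : TotalForm E M => evalZero p (α 0)) (iterContraction_comp totalInterior
      totalInterior_mul_self X hJ (m + 2) Ω x)).trans ?_
    have h2 := iterContraction_rev totalInterior totalInterior_mul_self (m + 2) Ω
      (fun i => X (x i.rev))
    simp only [Fin.rev_rev] at h2
    rw [h2, Pi.smul_apply, map_smul, evalZero_iterContraction, hΩ, singleForm_same]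
    simp only [Fin.rev_rev, smul_eq_mul]
  have hb : ∀ x, bracketOp b x = -ev (β m x) := by
    intro x
    have h2 : ev (β m x) = ev (bracketOp (g (m + 1)) x) + (-1 : ℝ) ^ m * ev (A (m + 2) x) := by
      change ev (bracketOp (g (m + 1)) x + (-1 : ℝ) ^ m • A (m + 2) x) = _
      rw [map_add, map_smul, smul_eq_mul]
    rw [h2, hevA, ← hz, ← bracketOp_apply z]
    simp only [b, bracketOp_sub, bracketOp_neg, bracketOp_smul, bracketOp_compAlternatingMap,
      AlternatingMap.sub_apply, AlternatingMap.neg_apply, AlternatingMap.smul_apply,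
      LinearMap.compAlternatingMap_apply, smul_eq_mul]
    ring
  let c : (k : ℕ) → 𝔤 [⋀^Fin k]→ₗ[ℝ] TotalForm E M :=
    Pi.single (m + 1) (cst.compAlternatingMap b)
  have hc1 : c (m + 1) = cst.compAlternatingMap b := Pi.single_eq_same ..
  have hc2 : ∀ k, k ≠ m + 1 → c k = 0 := fun k hk => Pi.single_eq_of_ne hk _
  refine ⟨fun k => g k + c k, ?_, ?_, ?_, ?_⟩
  · intro k x j hj
    change g k x j + c k x j = 0
    rw [hgconc k x j hj, zero_add]
    by_cases hk : k = m + 1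
    · subst hk
      rw [hc1]
      exact singleForm_of_ne (by omega) _
    · rw [hc2 k hk]
      rfl
  · intro k x
    rw [← bracketOp_apply, ← iterContraction_comp totalInterior totalInterior_mul_self X hJ]
    change bracketOp (g (k + 1) + c (k + 1)) x = totalD E M (g (k + 2) x + c (k + 2) x) +
      (-1 : ℝ) ^ (k + 1) • A (k + 2) x
    have hDc : totalD E M (c (k + 2) x) = 0 := by
      by_cases hk : k + 2 = m + 1
      · obtain rfl : m = k + 1 := by omega
        rw [hc1]
        exact hDcst _
      · rw [hc2 _ hk]
        exact map_zero _
    rw [map_add, hDc, add_zero, bracketOp_add, AlternatingMap.add_apply]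
    -- Below `m` the recursion already gives the equation, at `m` the constant correction is what
    -- makes it true, and above `m` every term vanishes for degree reasons.
    rcases lt_trichotomy k m with hk | rfl | hk
    · have h2 := DFunLike.congr_fun (hgD (k + 1) hk) x
      rw [hc2 _ (by omega), show (0 : 𝔤 [⋀^Fin (k + 1)]→ₗ[ℝ] TotalForm E M) =
        (0 : ℝ) • 0 by simp, bracketOp_smul, zero_smul, AlternatingMap.zero_apply, add_zero]
      exact sub_eq_iff_eq_add.1 h2.symm
    · have h2 : g (k + 2) x = 0 := funext fun j => hgconc _ x j (by omega)
      have h3 := hβtop x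
      change bracketOp (g (k + 1)) x + (-1 : ℝ) ^ k • A (k + 2) x = _ at h3
      rw [h2, map_zero, zero_add, hc1, bracketOp_compAlternatingMap,
        LinearMap.compAlternatingMap_apply, hb, map_neg, ← h3, pow_succ, mul_neg_one, neg_smul]
      abel
    · have h2 : g (k + 2) x = 0 := funext fun j => hgconc _ x j (by omega)
      have h3 : A (k + 2) x = 0 := funext fun j => hA _ x j (by omega)
      have h4 : bracketOp (g (k + 1)) x = 0 := funext fun j =>
        apply_bracketOp_eq_zero (fun x => hgconc _ x j (by omega)) x
      rw [h2, h3, h4, hc2 _ (by omega), show (0 : 𝔤 [⋀^Fin (k + 1)]→ₗ[ℝ] TotalForm E M) =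
        (0 : ℝ) • 0 by simp, bracketOp_smul]
      simp
  · intro hm x
    change g 1 ![x] + c 1 ![x] = _
    rw [hc2 1 (by omega), AlternatingMap.zero_apply, add_zero]
    exact hφ' ![x]
  · intro hm
    subst hm
    refine ⟨(AlternatingMap.ofSubsingleton ℝ 𝔤 ℝ (0 : Fin 1)).symm b, fun x => ?_⟩
    change g 1 ![x] + c 1 ![x] = _
    have h2 : c 1 = cst.compAlternatingMap b := hc1
    rw [h2]
    refine congrArg₂ (fun a b : TotalForm E M => a + b) (hφ' ![x]) ?_
    change cst (b ![x]) = cst (b fun _ => x)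
    congr 2
    funext i
    simp

end Components

/-! ### The morphism equation -/

section CompositionSum

open Classical in
/-- If `l p` for `p ≥ 2` vanishes as soon as some argument is in the image of some `f j` with `j ≥ 2`,
then only the two extreme compositions contribute to the morphism equation. -/
theorem sum_composition_eq {𝔤 T : Type*} [AddCommGroup 𝔤] [Module ℝ 𝔤] [AddCommGroup T]
    [Module ℝ T] (l : (p : ℕ) → (Fin p → T) → T) (f : (k : ℕ) → 𝔤 [⋀^Fin k]→ₗ[ℝ] T) {k : ℕ}
    (A : 𝔤 [⋀^Fin (k + 2)]→ₗ[ℝ] T) (hA : ∀ x, l (k + 2) (fun r => f 1 fun _ => x r) = A x)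
    (hl : ∀ p, 2 ≤ p → ∀ (u : Fin p → T) r j y, 2 ≤ j → u r = f j y → l p u = 0)
    (x : Fin (k + 2) → 𝔤) :
    ∑ c : Composition (k + 2), ((c.length.factorial : ℝ)⁻¹) •
        ∑ σ ∈ (Finset.univ : Finset (Equiv.Perm (Fin (k + 2)))).filter
            (fun σ => ∀ r, StrictMono fun a => σ (c.embedding r a)),
          (((Equiv.Perm.sign σ : ℤ) : ℝ) * (-1) ^ (c.length * (c.length - 1) / 2 +
              ∑ r : Fin c.length, (c.length - 1 - r) * c.blocksFun r)) •
            l c.length (fun r => f (c.blocksFun r) (fun a => x (σ (c.embedding r a)))) =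
      l 1 (fun _ => f (k + 2) x) + A x := by
  have h0 : 0 < k + 2 := by omega
  have hne : Composition.single (k + 2) h0 ≠ Composition.ones (k + 2) := by
    intro h
    have := congrArg Composition.length h
    rw [Composition.single_length, Composition.ones_length] at this
    omega
  rw [Finset.sum_eq_add (Composition.single (k + 2) h0) (Composition.ones (k + 2)) hne]
  · congr 1
    · have hf : (Finset.univ : Finset (Equiv.Perm (Fin (k + 2)))).filter
          (fun σ => ∀ r, StrictMono fun a =>
            σ ((Composition.single (k + 2) h0).embedding r a)) = {1} := by
        ext σ
        simp only [Finset.mem_filter, Finset.mem_univ, true_and, Finset.mem_singleton]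
        constructor
        · intro h
          -- With a single block an unshuffle is an increasing permutation, hence the identity.
          have h1 : StrictMono σ := by
            have h2 := h ⟨0, by simp⟩
            have e : ∀ a, (Composition.single (k + 2) h0).embedding ⟨0, by simp⟩ a = a :=
              Composition.single_embedding h0
            intro a b hab
            exact lt_of_eq_of_lt (congrArg σ (e a)).symm
              (lt_of_lt_of_eq (h2 (a := a) (b := b) hab) (congrArg σ (e b)))
          have h4 : (σ : Fin (k + 2) → Fin (k + 2)) = id :=
            (h1.range_inj strictMono_id).1 (by simp)
          exact Equiv.ext fun a => congrFun h4 a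
        · rintro rfl r
          exact ((Composition.single (k + 2) h0).embedding r).strictMono
      rw [hf, Finset.sum_singleton]
      have hlen : (Composition.single (k + 2) h0).length = 1 := rfl
      -- The length and block sizes equal the expected numbers only propositionally; generalizing
      -- over them allows substitution in the dependent arguments.
      have key : ∀ p (hp : p = 1) (b : Fin p → ℕ) (hb : ∀ r, b r = k + 2)
          (e : ∀ r, Fin (b r) → 𝔤) (he : ∀ r a, e r a = x (Fin.cast (hb r) a)),
          ((p.factorial : ℝ)⁻¹) • ((((Equiv.Perm.sign (1 : Equiv.Perm (Fin (k + 2))) : ℤ) : ℝ) *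
            (-1) ^ (p * (p - 1) / 2 + ∑ r : Fin p, (p - 1 - r) * b r)) •
              l p (fun r => f (b r) (e r))) = l 1 (fun _ => f (k + 2) x) := by
        rintro p rfl b hb e he
        obtain rfl : b = fun _ => k + 2 := funext hb
        obtain rfl : e = fun _ => x := funext fun r => funext fun a => he r a
        simp
      refine key _ hlen _ (fun r => Composition.single_blocksFun h0 r) _ fun r a => ?_
      obtain rfl : r = ⟨0, by simp⟩ := by
        have h1 := lt_of_lt_of_eq r.2 hlen
        exact Fin.ext (Nat.lt_one_iff.1 h1)
      exact congrArg x (Composition.single_embedding h0 _)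
    · have hf : (Finset.univ : Finset (Equiv.Perm (Fin (k + 2)))).filter
          (fun σ => ∀ r, StrictMono fun a =>
            σ ((Composition.ones (k + 2)).embedding r a)) = Finset.univ := by
        refine Finset.filter_true_of_mem fun σ _ r => ?_
        have : Subsingleton (Fin ((Composition.ones (k + 2)).blocksFun r)) := by
          rw [Composition.ones_blocksFun]; infer_instance
        exact Subsingleton.strictMono _
      rw [hf]
      have key : ∀ p (hp : p = k + 2) (b : Fin p → ℕ) (hb : ∀ r, b r = 1)
          (e : Equiv.Perm (Fin (k + 2)) → ∀ r, Fin (b r) → 𝔤)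
          (he : ∀ σ r a, e σ r a = x (σ (Fin.cast hp r))),
          ((p.factorial : ℝ)⁻¹) • ∑ σ : Equiv.Perm (Fin (k + 2)),
            (((Equiv.Perm.sign σ : ℤ) : ℝ) *
            (-1) ^ (p * (p - 1) / 2 + ∑ r : Fin p, (p - 1 - r) * b r)) •
              l p (fun r => f (b r) (e σ r)) = A x := by
        rintro p rfl b hb e he
        obtain rfl : b = fun _ => 1 := funext hb
        -- The sum over `r` equals `p(p-1)/2` for `p = k + 2`, so the exponent is twice an integer
        -- and the sign is trivial.
        have hexp : Even ((k + 2) * (k + 2 - 1) / 2 +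
            ∑ r : Fin (k + 2), (k + 2 - 1 - (r : ℕ)) * 1) := by
          have h1 : ∑ r : Fin (k + 2), (k + 2 - 1 - (r : ℕ)) * 1 = (k + 2) * (k + 2 - 1) / 2 := by
            rw [Fin.sum_univ_eq_sum_range (fun r => (k + 2 - 1 - r) * 1) (k + 2)]
            simp only [mul_one]
            rw [Finset.sum_range_reflect (fun r => r) (k + 2), Finset.sum_range_id]
          rw [h1]
          exact ⟨_, rfl⟩
        rw [hexp.neg_one_pow]
        -- As `A` is alternating, permuting its arguments cancels `sgn(σ)`. All `p!` permutations
        -- contribute equally, which absorbs the factor `1/p!`.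
        have hterm : ∀ σ : Equiv.Perm (Fin (k + 2)),
            (((Equiv.Perm.sign σ : ℤ) : ℝ) * 1) • l (k + 2) (fun r => f 1 (e σ r)) = A x := by
          intro σ
          have h1 : l (k + 2) (fun r => f 1 (e σ r)) = A (x ∘ σ) := by
            rw [← hA]
            exact congrArg (l (k + 2)) (funext fun r => congrArg (f 1) (funext fun a => he σ r a))
          rw [h1, A.map_perm, mul_one, Units.smul_def, ← Int.cast_smul_eq_zsmul ℝ, smul_smul,
            ← Int.cast_mul, ← Units.val_mul, Int.units_mul_self]
          simp
        rw [Finset.sum_congr rfl fun σ _ => hterm σ, Finset.sum_const, Finset.card_univ,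
          Fintype.card_perm, Fintype.card_fin, ← Nat.cast_smul_eq_nsmul ℝ, smul_smul,
          inv_mul_cancel₀ (Nat.cast_ne_zero.2 (Nat.factorial_ne_zero _)), one_smul]
      refine key _ (Composition.ones_length _) _ (fun r => Composition.ones_blocksFun _ r) _
        fun σ r a => ?_
      refine congrArg (fun i => x (σ i)) ?_
      obtain rfl : a = ⟨0, by rw [Composition.ones_blocksFun]; exact one_pos⟩ := by
        have h1 := lt_of_lt_of_eq a.2 (Composition.ones_blocksFun _ r)
        exact Fin.ext (Nat.lt_one_iff.1 h1)
      exact Composition.ones_embedding r _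
  · rintro c - ⟨hc1, hc2⟩
    -- Any other composition has at least two blocks, one of them of size at least two, so `hl`
    -- annihilates its bracket.
    have hlen : 2 ≤ c.length := by
      have h1 : c.length ≠ 1 := fun h => hc1 ((Composition.eq_single_iff_length h0).2 h)
      have h2 : 0 < c.length := c.length_pos_of_pos h0
      omega
    obtain ⟨i, hi, hi1⟩ := Composition.ne_ones_iff.1 hc2
    rw [← c.ofFn_blocksFun, List.mem_ofFn', Set.mem_range] at hi
    obtain ⟨r, rfl⟩ := hi
    rw [Finset.sum_eq_zero, smul_zero]
    intro σ _
    rw [hl _ hlen _ r _ _ hi1 rfl, smul_zero]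
  · simp
  · simp

end CompositionSum

/-! ### Dependence of iterated contractions on their arguments -/

section IteratedContractionCongr

variable {V T : Type*} [AddCommGroup V] [Module ℝ V] [AddCommGroup T] [Module ℝ T]
  (I : V →ₗ[ℝ] Module.End ℝ T) (hI : ∀ a, I a * I a = 0)


/-- Contractions anticommute, so each `v i` can be brought next to `α`; only the values `I (v i) α`
matter. This is what makes the multibrackets independent of the chosen Hamiltonian vector fields. -/
theorem iterContraction_congr (k : ℕ) {α : T} {v v' : Fin k → V} (h : ∀ i, I (v i) α = I (v' i) α) :
    iterContraction I hI k α v = iterContraction I hI k α v' := by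
  have hswap : ∀ a b β, I a (I b β) = -I b (I a β) := fun a b β => by
    have h1 := LinearMap.congr_fun (hI (a + b)) β
    have h2 := LinearMap.congr_fun (hI a) β
    have h3 := LinearMap.congr_fun (hI b) β
    simp only [Module.End.mul_apply, LinearMap.zero_apply, map_add, LinearMap.add_apply] at h1 h2 h3
    rw [h2, h3, zero_add, add_zero] at h1
    exact eq_neg_of_add_eq_zero_right h1
  induction k generalizing α with
  | zero => rw [iterContraction_zero, iterContraction_zero]
  | succ k ih =>
    rw [← Fin.snoc_init_self v, ← Fin.snoc_init_self v', iterContraction_snoc, iterContraction_snoc,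
      h (Fin.last k)]
    refine ih fun i => ?_
    rw [hswap, hswap (Fin.init v' i)]
    exact congrArg (fun β => -I _ β) (h i.castSucc)

theorem iterContraction_eq_zero (k : ℕ) {α : T} {v : Fin k → V} (i : Fin k) (h : I (v i) α = 0) :
    iterContraction I hI k α v = 0 := by
  rw [iterContraction_congr I hI k (v' := Function.update v i 0) fun j => ?_]
  · exact AlternatingMap.map_coord_zero _ i (Function.update_self ..)
  · rcases eq_or_ne j i with rfl | hj
    · rw [Function.update_self, h, map_zero, LinearMap.zero_apply]
    · rw [Function.update_of_ne hj]

end IteratedContractionCongr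

/-! ### The multibrackets of observables -/

section Observables

variable {E M : Type*} [NormedAddCommGroup E] [NormedSpace ℝ E] [TopologicalSpace M]
  [ChartedSpace E M] [IsManifold 𝓘(ℝ, E) ∞ M] {m : ℕ} (ϖ : Form E M (m + 2))

theorem isHamiltonianFor_hamVField {α : Form E M m} {v : VField E M} (h : IsHamiltonianFor ϖ α v) :
    IsHamiltonianFor ϖ α (hamVField ϖ α) := by
  have h' : ∃ v, IsHamiltonianFor ϖ α v := ⟨v, h⟩
  rw [hamVField, dif_pos h']
  exact h'.choose_spec

theorem interior_hamVField {α : Form E M m} {v : VField E M} (h : IsHamiltonianFor ϖ α v) :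
    interior (hamVField ϖ α) ϖ = interior v ϖ :=
  neg_injective ((isHamiltonianFor_hamVField ϖ h).symm.trans h)

theorem obsBracket_eq (p : ℕ) (α : Fin (p + 2) → TotalForm E M) :
    obsBracket ϖ (p + 2) α = (-1 : ℝ) ^ (p + 3) • iterContraction totalInterior
      totalInterior_mul_self (p + 2) (singleForm (m + 2) ϖ) (fun r => hamVField ϖ (α r m)) := by
  funext k
  rw [Pi.smul_apply]
  by_cases h : m + 2 = k + (p + 2)
  -- After this substitution the transport of `ϖ` along the degree equality is along `rfl`.
  · obtain rfl : m = k + p := by omega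
    have h1 := varsig_smul_contract (p + 2) k (fun r => hamVField ϖ (α r (k + p)))
      (singleForm (k + p + 2) ϖ)
    rw [← h1]
    exact (dif_pos rfl).trans (congrArg (fun η => varsig (p + 2) • contract (p + 2) _ η)
      (singleForm_same _ ϖ).symm)
  · have h1 := iterContraction_apply_eq_zero LinearMap.id totalInterior_mul_self
      (fun j hj => singleForm_of_ne hj ϖ) _ (Ne.symm h) (fun r => hamVField ϖ (α r m))
    exact (dif_neg h).trans ((congrArg ((-1 : ℝ) ^ (p + 3) • ·) h1).trans (smul_zero _)).symm

theorem obsBracket_eq_of_isHamiltonianFor (p : ℕ) {α : Fin (p + 2) → TotalForm E M}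
    {v : Fin (p + 2) → VField E M} (h : ∀ r, IsHamiltonianFor ϖ (α r m) (v r)) :
    obsBracket ϖ (p + 2) α = (-1 : ℝ) ^ (p + 3) • iterContraction totalInterior
      totalInterior_mul_self (p + 2) (singleForm (m + 2) ϖ) v := by
  rw [obsBracket_eq]
  congr 1
  refine iterContraction_congr _ _ _ fun i => ?_
  rw [totalInterior_singleForm, totalInterior_singleForm, interior_hamVField ϖ (h i)]

/-- A negative-degree argument has zero component in degree `m`. The Hamiltonian field chosen for
the zero form need not vanish, but its contraction with `ϖ` does, and that suffices. -/
theorem obsBracket_eq_zero {p : ℕ} (hp : 2 ≤ p) {α : Fin p → TotalForm E M} (r : Fin p)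
    (h : α r m = 0) : obsBracket ϖ p α = 0 := by
  obtain ⟨p, rfl⟩ := Nat.exists_eq_add_of_le' hp
  have h0 : IsHamiltonianFor ϖ (α r m) 0 := by
    rw [IsHamiltonianFor, h, map_zero]
    exact (neg_eq_zero.2 (interior_zero ϖ)).symm
  rw [obsBracket_eq, iterContraction_eq_zero _ _ _ r, smul_zero]
  rw [totalInterior_singleForm, interior_hamVField ϖ h0]
  exact (congrArg (singleForm (m + 1)) (interior_zero ϖ)).trans (map_zero _)

theorem obsDiff_eq_totalD {α : TotalForm E M} (h : ∀ k, m ≤ k → α k = 0) :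
    obsDiff m α = totalD E M α := by
  funext k
  cases k with
  | zero => rw [totalD_zero]; rfl
  | succ k =>
    rw [totalD_succ]
    by_cases hk : k < m
    · exact if_pos hk
    · rw [h k (by omega), map_zero]
      exact if_neg hk

theorem obsDiff_eq_zero {α : TotalForm E M} (h : ∀ k, k < m → α k = 0) :
    obsDiff m α = 0 := by
  funext k
  cases k with
  | zero => rfl
  | succ k =>
    by_cases hk : k < m
    · exact (if_pos hk).trans ((congrArg _ (h k hk)).trans (map_zero _))
    · exact if_neg hk

variable {𝔤 : Type*} [LieRing 𝔤] [LieAlgebra ℝ 𝔤]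

/-- For `k ≥ 2` the forms `f k x` lie below degree `m`: brackets of arity at least two kill them,
and the truncated differential agrees with `totalD` on them. This reduces the full morphism equation
to `heq`. -/
theorem isLInftyMorphism_of_components {X : 𝔤 →ₗ[ℝ] VField E M}
    {f : (k : ℕ) → 𝔤 [⋀^Fin k]→ₗ[ℝ] TotalForm E M}
    (hf : ∀ k x j, j + k ≠ m + 1 → f k x j = 0)
    (heq : ∀ k x, bracketSum (f (k + 1)) x = totalD E M (f (k + 2) x) +
      (-1 : ℝ) ^ (k + 1) • iterContraction totalInterior totalInterior_mul_self (k + 2)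
        (singleForm (m + 2) ϖ) (fun i => X (x i)))
    (hlift : ∀ x, IsHamiltonianFor ϖ (f 1 ![x] m) (X x)) :
    IsLInftyMorphism (obsDegree ϖ) (obsBracket ϖ) f where
  degree k hk x := by
    refine ⟨fun j hj => hf k x j (by omega), ?_⟩
    rcases hk.eq_or_lt with rfl | hk
    · obtain ⟨a, rfl⟩ : ∃ a, x = ![a] :=
        ⟨x 0, funext fun i => by rw [Matrix.cons_fin_one, Fin.fin_one_eq_zero i]⟩
      exact ⟨_, hlift a⟩
    · rw [hf k x m (by omega)]
      exact zero_mem _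
  compat_one x := obsDiff_eq_zero fun k hk => hf 1 x k (by omega)
  compat k x := by
    have hX : ∀ a, (totalInterior ∘ₗ X) a * (totalInterior ∘ₗ X) a = 0 := fun a =>
      totalInterior_mul_self (X a)
    refine Eq.trans ?_ (sum_composition_eq (obsBracket ϖ) f ((-1 : ℝ) ^ (k + 3) •
      iterContraction (totalInterior ∘ₗ X) hX (k + 2) (singleForm (m + 2) ϖ)) (fun x => ?_) ?_ x).symm
    · rw [heq, AlternatingMap.smul_apply, iterContraction_comp totalInterior totalInterior_mul_self]
      have h1 : obsBracket ϖ 1 (fun _ => f (k + 2) x) = totalD E M (f (k + 2) x) :=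
        obsDiff_eq_totalD fun j hj => hf _ x j (by omega)
      -- The multibracket carries `(-1)^(k+3)`, which agrees with the sign `(-1)^(k+1)` in `heq`.
      rw [h1, pow_add _ k 3, pow_add _ k 1]
      norm_num
    · rw [AlternatingMap.smul_apply, iterContraction_comp totalInterior totalInterior_mul_self]
      refine obsBracket_eq_of_isHamiltonianFor ϖ k fun r => ?_
      have h := hlift (x r)
      rwa [Matrix.cons_fin_one] at h
    · intro p hp u r j y hj hu
      exact obsBracket_eq_zero ϖ hp r (by rw [hu, hf j y m (by omega)])

end Observables

/-! ### The fundamental vector fields and the moment cochain -/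

section Action

variable {E M F G : Type*} [NormedAddCommGroup E] [NormedSpace ℝ E] [TopologicalSpace M]
  [ChartedSpace E M]
  [NormedAddCommGroup F] [NormedSpace ℝ F] [TopologicalSpace G] [ChartedSpace F G] [Group G]
  [LieGroup 𝓘(ℝ, F) ∞ G] [MulAction G M]

/-- The factor `s` in the moment cochain squares to one, and the Chevalley–Eilenberg differential is
minus `bracketSum`. Rescaling a primitive of the cochain by `-s` removes both signs. -/
theorem exists_bracketSum_eq_of_momentCochain [CompleteSpace F] {m : ℕ} {ϖ : Form E M (m + 2)} {p : M}
    (hc : ∃ z : LinearMap.ker (ceD (𝔤 := GroupLieAlgebra 𝓘(ℝ, F) G) (m + 2)),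
      (z : CECochain (GroupLieAlgebra 𝓘(ℝ, F) G) (m + 2)) = momentCochain F G ϖ p ∧
        (Submodule.Quotient.mk z : CECohomology (GroupLieAlgebra 𝓘(ℝ, F) G) (m + 2)) = 0) :
    ∃ z : GroupLieAlgebra 𝓘(ℝ, F) G [⋀^Fin (m + 1)]→ₗ[ℝ] ℝ,
      ∀ x, bracketSum z x = ϖ.1 p (fun i => fundAt E F G p (x i)) := by
  obtain ⟨z, hz, hz0⟩ := hc
  rw [Submodule.Quotient.mk_eq_zero] at hz0
  obtain ⟨c, hc⟩ : ∃ c, ceD (m + 1) c = (z : CECochain (GroupLieAlgebra 𝓘(ℝ, F) G) (m + 2)) := hz0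
  rw [hz] at hc
  let s : ℝ := (-1) ^ (m + 1) * varsig (m + 2)
  have hs : s * s = 1 := by
    have h1 : ((-1 : ℝ) ^ (m + 1)) * (-1) ^ (m + 1) = 1 := by rw [← mul_pow]; simp
    have h2 := varsig_mul_self (m + 2)
    simp only [s]
    linear_combination h1 + (-1 : ℝ) ^ (m + 1) * (-1) ^ (m + 1) * h2
  let c' : GroupLieAlgebra 𝓘(ℝ, F) G [⋀^Fin (m + 1)]→ₗ[ℝ] ℝ := c
  refine ⟨(-s) • c', fun x => ?_⟩
  have h : -bracketSum c' x = s * ϖ.1 p (fun i => fundAt E F G p (x i)) :=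
    congrArg (fun a : GroupLieAlgebra 𝓘(ℝ, F) G [⋀^Fin (m + 2)]→ₗ[ℝ] ℝ => a x) hc
  rw [bracketSum_smul, smul_eq_mul]
  linear_combination s * h + ϖ.1 p (fun i => fundAt E F G p (x i)) * hs

/-- The fundamental vector fields, as a linear map on the Lie algebra. -/
noncomputable def fundVFieldₗ (E M F G : Type*) [NormedAddCommGroup E] [NormedSpace ℝ E]
    [TopologicalSpace M] [ChartedSpace E M] [IsManifold 𝓘(ℝ, E) ∞ M]
    [NormedAddCommGroup F] [NormedSpace ℝ F] [TopologicalSpace G] [ChartedSpace F G] [Group G]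
    [LieGroup 𝓘(ℝ, F) ∞ G] [MulAction G M] [ContMDiffSMul 𝓘(ℝ, F) 𝓘(ℝ, E) ∞ G M] :
    GroupLieAlgebra 𝓘(ℝ, F) G →ₗ[ℝ] VField E M where
  toFun := fundVField
  map_add' x y := ContMDiffSection.ext fun p => (fundAt E F G p).map_add x y
  map_smul' r x := ContMDiffSection.ext fun p => (fundAt E F G p).map_smul r x

end Action

end HomotopyMoment

/-! ### The main theorem -/

open HomotopyMoment
theorem mainTheorem3 {E M F G : Type*} [NormedAddCommGroup E] [NormedSpace ℝ E] [CompleteSpace E]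
    [TopologicalSpace M] [ChartedSpace E M] [IsManifold 𝓘(ℝ, E) ∞ M] [ConnectedSpace M]
    [NormedAddCommGroup F] [NormedSpace ℝ F] [CompleteSpace F] [TopologicalSpace G]
    [ChartedSpace F G] [Group G] [LieGroup 𝓘(ℝ, F) ∞ G] [MulAction G M]
    [ContMDiffSMul 𝓘(ℝ, F) 𝓘(ℝ, E) ∞ G M]
    (m : ℕ) (ϖ : Form E M (m + 2)) (hϖ : extD (m + 2) ϖ = 0)
    (hG : ∀ x : GroupLieAlgebra 𝓘(ℝ, F) G, IsHamiltonianVField ϖ (fundVField x : VField E M))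
    (φ : GroupLieAlgebra 𝓘(ℝ, F) G →ₗ[ℝ] hamiltonianForms ϖ)
    (hφ : ∀ x, IsHamiltonianFor ϖ (φ x : Form E M m) (fundVField x))
    (hdR : ∀ i : ℕ, 1 ≤ i → i ≤ m → Subsingleton (DeRhamCohomology E M i))
    (p : M)
    (hc : ∃ z : LinearMap.ker (ceD (𝔤 := GroupLieAlgebra 𝓘(ℝ, F) G) (m + 2)),
      (z : CECochain (GroupLieAlgebra 𝓘(ℝ, F) G) (m + 2)) = momentCochain F G ϖ p ∧
        (Submodule.Quotient.mk z : CECohomology (GroupLieAlgebra 𝓘(ℝ, F) G) (m + 2)) = 0) :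
    ∃ f : (k : ℕ) → GroupLieAlgebra 𝓘(ℝ, F) G [⋀^Fin k]→ₗ[ℝ] TotalForm E M,
      IsHomotopyMomentMap ϖ f ∧
      (1 ≤ m → ∀ x, f 1 ![x] = Pi.single m (φ x : Form E M m)) ∧
      (m = 0 → ∃ b : GroupLieAlgebra 𝓘(ℝ, F) G →ₗ[ℝ] ℝ, ∀ x q w,
        (f 1 ![x] m).1 q w = (φ x : Form E M m).1 q w + b x) := by
  obtain ⟨z, hz⟩ := exists_bracketSum_eq_of_momentCochain hc
  obtain ⟨f, hf, heq, h1, h0⟩ := exists_components (fundVFieldₗ E M F G) isLieBracket_fundVField m ϖ hϖ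
    ((hamiltonianForms ϖ).subtype ∘ₗ φ) hφ hdR p z hz
  -- When `m = 0` the first component was shifted by a constant, which does not change its
  -- differential.
  have hlift : ∀ x, IsHamiltonianFor ϖ (f 1 ![x] m) (fundVField x) := fun x => by
    rcases Nat.eq_zero_or_pos m with rfl | hm
    · obtain ⟨b, hb⟩ := h0 rfl
      rw [hb, Pi.add_apply, singleForm_same, singleForm_same, IsHamiltonianFor, map_add,
        extD_constForm, add_zero]
      exact hφ x
    · rw [h1 hm, singleForm_same]
      exact hφ x
  refine ⟨f, ⟨isLInftyMorphism_of_components ϖ hf heq hlift, hlift⟩, h1, ?_⟩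
  rintro rfl
  obtain ⟨b, hb⟩ := h0 rfl
  refine ⟨b, fun x q w => ?_⟩
  rw [hb, Pi.add_apply, singleForm_same, singleForm_same]
  exact congrArg (((φ x : Form E M 0).1 q w) + ·) (constForm_apply (E := E) (b x) q w)
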